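/- **Lemma 2.6 (label thickening).** Let $G$ be a (discrete) group. A *$G$-complex* is a space $X$ on which $G$ acts by homeomorphisms, together with a filtration $\emptyset = X_{-1}\subseteq X_0\subseteq X_1\subseteq\cdots$ such that $X=\bigcup_n X_n$ has the colimit topology and, for each $n\ge 0$, $X_n$ is obtained from $X_{n-1}$ by attaching a family of equivariant $n$-cells $G/H_i\times D^n$ (with subgroups $H_i\le G$) along $G$-maps $G/H_i\times S^{n-1}\to X_{n-1}$. It is *finite dimensional* if for some $N$ it has no $n$-cells with $n>N$. A *$G$-map* is a continuous $G$-equivariant map. Let $X$ be a finite dimensional contractible $G$-complex such that the stabilizer $G_x$ of every point $x\in X$ is countable. Then there is a finite dimensional contractible $G$-complex $Y$ which admits a $G$-map $Y\to X$ and such that for every point $y\in Y$ the stabilizer $G_y$ is contained in some finitely generated subgroup of $G$. -/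

import Mathlib

universe u v

/-- The closed unit disc `D^n` in Euclidean `n`-space. Its boundary sphere is `{x | ‖x‖ = 1}`
(empty for `n = 0`) and its interior is `{x | ‖x‖ < 1}`. -/
abbrev UnitDisc (n : ℕ) : Type :=
  Metric.closedBall (0 : EuclideanSpace ℝ (Fin n)) 1

/-- The structure of a `G`-complex (equivariant CW-complex) on a `G`-space `X`, for a discrete
group `G`: a filtration `∅ = X_{-1} ⊆ X_0 ⊆ X_1 ⊆ ⋯` of `X`, where `skelLT n` is `X_{n-1}`, such
that `X_n` is obtained from `X_{n-1}` by attaching equivariant `n`-cells `G/H_i × D^n` along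
`G`-maps `G/H_i × S^{n-1} → X_{n-1}`, and `X` is the union of the `X_n` with the colimit topology.
The orbits `G/H_i` carry the discrete topology, so that a subset of `G/H_i × D^n` is closed as soon
as its slices are, and likewise for continuity. -/
structure GComplex (G : Type u) [Group G] (X : Type v) [TopologicalSpace X] [MulAction G X]
    [ContinuousConstSMul G X] where
  /-- The type indexing the equivariant `n`-cells. -/
  cell : ℕ → Type v
  /-- The subgroup `H_i` of the equivariant cell `G/H_i × D^n`. -/
  stab : ∀ n : ℕ, cell n → Subgroup G
  /-- The characteristic map `G/H_i × D^n → X`. -/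
  charMap : ∀ (n : ℕ) (i : cell n), G ⧸ stab n i → UnitDisc n → X
  /-- `skelLT n` is the `(n-1)`-skeleton. -/
  skelLT : ℕ → Set X
  charMap_smul : ∀ (n : ℕ) (i : cell n) (g : G) (c : G ⧸ stab n i) (x : UnitDisc n),
    charMap n i (g • c) x = g • charMap n i c x
  continuous_charMap : ∀ (n : ℕ) (i : cell n) (c : G ⧸ stab n i), Continuous (charMap n i c)
  skelLT_zero : skelLT 0 = ∅
  skelLT_succ : ∀ n : ℕ,
    skelLT (n + 1) = skelLT n ∪ ⋃ (i : cell n) (c : G ⧸ stab n i), Set.range (charMap n i c)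
  /-- The boundary of an `n`-cell is mapped into the `(n-1)`-skeleton. -/
  charMap_mem : ∀ (n : ℕ) (i : cell n) (c : G ⧸ stab n i) (x : UnitDisc n),
    ‖(x : EuclideanSpace ℝ (Fin n))‖ = 1 → charMap n i c x ∈ skelLT n
  /-- The interior of an `n`-cell is disjoint from the `(n-1)`-skeleton. -/
  charMap_notMem : ∀ (n : ℕ) (i : cell n) (c : G ⧸ stab n i) (x : UnitDisc n),
    ‖(x : EuclideanSpace ℝ (Fin n))‖ < 1 → charMap n i c x ∉ skelLT n
  /-- The characteristic maps of the `n`-cells are jointly injective on the interiors. -/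
  charMap_injOn : ∀ n : ℕ, Set.InjOn
    (fun p : Σ i : cell n, (G ⧸ stab n i) × UnitDisc n => charMap n p.1 p.2.1 p.2.2)
    {p | ‖(p.2.2 : EuclideanSpace ℝ (Fin n))‖ < 1}
  /-- The `n`-skeleton has the topology of the pushout of the `(n-1)`-skeleton and the
  `n`-cells. -/
  isClosed_iff : ∀ (n : ℕ) (A : Set X), A ⊆ skelLT (n + 1) →
    (IsClosed A ↔ IsClosed (A ∩ skelLT n) ∧
      ∀ (i : cell n) (c : G ⧸ stab n i), IsClosed (charMap n i c ⁻¹' A))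
  iUnion_skelLT : ⋃ n : ℕ, skelLT n = Set.univ
  /-- `X` has the colimit topology with respect to its skeleta. -/
  isClosed_of_skelLT : ∀ A : Set X, (∀ n : ℕ, IsClosed (A ∩ skelLT n)) → IsClosed A

/-- A `G`-complex is finite dimensional if it has no cells above some dimension. -/
def GComplex.FiniteDimensional {G : Type u} [Group G] {X : Type v} [TopologicalSpace X]
    [MulAction G X] [ContinuousConstSMul G X] (C : GComplex G X) : Prop :=
  ∃ N : ℕ, ∀ n : ℕ, N < n → IsEmpty (C.cell n)

/-! Each cell subgroup `H` is countable, hence an increasing union of finitely generated subgroups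
`F_k`. If `X` were a single orbit `G/H`, the mapping telescope of `G/F_0 → G/F_1 → ⋯` would do: it
is homotopy equivalent to `G/H`, and its stabilizers are conjugates of the `F_k`.

For general `X` such telescopes must fit together along boundaries of cells. One `G`-set `W` of
labels is therefore used everywhere: a label picks a coset representative for every cell. Over `x`
at height `t`, two labels are identified if on each cell of the smallest subcomplex containing `x`
their ratio lies in the `⌊t⌋`-th subgroup. Passing to a boundary point drops conditions, so the
quotient `Y` of `X × [0,∞) × W` has cells `e × {k}` and `e × [k,k+1]`
(`isClosed_iff_of_subset_skel`). A stabilizer in `Y` lies in a conjugate of some `F_k`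
(`exists_fg_stabilizer_le`).

These subcomplexes have finitely many cells (`finite_below`), so any two labels over `x` become
related at some level, and each fibre of `Y → X` is a telescope with colimit a point. Induction over
skeleta (`IsDeformation.extend`) converts this into a homotopy from the identity of `Y` to a map
factoring through the contractible space `X`. -/

open Set
open scoped NNReal

universe w

/-! ### Point-set topology of `G`-complexes -/

namespace GComplex

variable {G : Type u} [Group G] {X : Type v} [TopologicalSpace X] [MulAction G X]
  [ContinuousConstSMul G X] (C : GComplex G X)

/-- The `G`-set of (non-equivariant) `n`-cells. -/
abbrev Cell (n : ℕ) : Type (max u v) := Σ i : C.cell n, G ⧸ C.stab n i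

/-- The characteristic map of a cell. -/
def map {n : ℕ} (e : C.Cell n) : UnitDisc n → X := C.charMap n e.1 e.2

lemma map_smul {n : ℕ} (g : G) (e : C.Cell n) (z : UnitDisc n) :
    C.map (g • e) z = g • C.map e z := C.charMap_smul n e.1 g e.2 z

lemma continuous_map {n : ℕ} (e : C.Cell n) : Continuous (C.map e) :=
  C.continuous_charMap n e.1 e.2

lemma map_mem {n : ℕ} (e : C.Cell n) (z : UnitDisc n) : C.map e z ∈ C.skelLT (n + 1) := by
  rw [C.skelLT_succ]
  exact Or.inr (mem_iUnion₂.2 ⟨e.1, e.2, z, rfl⟩)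

lemma map_mem_of_norm_eq {n : ℕ} (e : C.Cell n) (z : UnitDisc n) (hz : ‖z.1‖ = 1) :
    C.map e z ∈ C.skelLT n := C.charMap_mem n e.1 e.2 z hz

lemma map_notMem {n : ℕ} (e : C.Cell n) (z : UnitDisc n) (hz : ‖z.1‖ < 1) :
    C.map e z ∉ C.skelLT n := C.charMap_notMem n e.1 e.2 z hz

lemma skelLT_mono : Monotone C.skelLT :=
  monotone_nat_of_le_succ fun n => by rw [C.skelLT_succ]; exact subset_union_left

lemma exists_of_mem_skelLT_succ {n : ℕ} {x : X} (hx : x ∈ C.skelLT (n + 1)) :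
    x ∈ C.skelLT n ∨ ∃ (e : C.Cell n) (z : UnitDisc n), C.map e z = x := by
  rw [C.skelLT_succ] at hx
  refine hx.imp_right fun h => ?_
  obtain ⟨i, c, z, rfl⟩ := mem_iUnion₂.1 h
  exact ⟨⟨i, c⟩, z, rfl⟩

end GComplex

lemma UnitDisc.norm_lt_or_eq {n : ℕ} (z : UnitDisc n) : ‖z.1‖ < 1 ∨ ‖z.1‖ = 1 :=
  lt_or_eq_of_le (mem_closedBall_zero_iff.1 z.2)

/-- The center of the unit disc. -/
def UnitDisc.center (n : ℕ) : UnitDisc n := ⟨0, by simp⟩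

lemma UnitDisc.norm_center_lt (n : ℕ) : ‖(UnitDisc.center n).1‖ < 1 := by
  simp [UnitDisc.center]

namespace GComplex

variable {G : Type u} [Group G] {X : Type v} [TopologicalSpace X] [MulAction G X]
  [ContinuousConstSMul G X] (C : GComplex G X)

lemma exists_interior_of_mem_skelLT {n : ℕ} {x : X} (hx : x ∈ C.skelLT n) :
    ∃ m < n, ∃ (e : C.Cell m) (z : UnitDisc m), ‖z.1‖ < 1 ∧ C.map e z = x := by
  induction n with
  | zero => simp [C.skelLT_zero] at hx
  | succ n ih =>
    have key : x ∈ C.skelLT n →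
        ∃ m < n + 1, ∃ (e : C.Cell m) (z : UnitDisc m), ‖z.1‖ < 1 ∧ C.map e z = x := fun h => by
      obtain ⟨m, hm, h⟩ := ih h
      exact ⟨m, hm.trans n.lt_succ_self, h⟩
    rcases C.exists_of_mem_skelLT_succ hx with h | ⟨e, z, rfl⟩
    · exact key h
    · rcases z.norm_lt_or_eq with hz | hz
      · exact ⟨n, n.lt_succ_self, e, z, hz, rfl⟩
      · exact key (C.map_mem_of_norm_eq e z hz)

lemma exists_interior (x : X) :
    ∃ (m : ℕ) (e : C.Cell m) (z : UnitDisc m), ‖z.1‖ < 1 ∧ C.map e z = x := by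
  obtain ⟨n, hn⟩ := mem_iUnion.1 (C.iUnion_skelLT.symm ▸ mem_univ x)
  obtain ⟨m, -, h⟩ := C.exists_interior_of_mem_skelLT hn
  exact ⟨m, h⟩

lemma map_inj {n : ℕ} {e e' : C.Cell n} {z z' : UnitDisc n} (hz : ‖z.1‖ < 1) (hz' : ‖z'.1‖ < 1)
    (h : C.map e z = C.map e' z') : e = e' ∧ z = z' := by
  obtain ⟨i, c⟩ := e
  obtain ⟨i', c'⟩ := e'
  have key := C.charMap_injOn n (show (⟨i, c, z⟩ : Σ i : C.cell n, (G ⧸ C.stab n i) × UnitDisc n) ∈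
    {p | ‖p.2.2.1‖ < 1} from hz) (show (⟨i', c', z'⟩ : Σ i : C.cell n, (G ⧸ C.stab n i) × UnitDisc n)
      ∈ {p | ‖p.2.2.1‖ < 1} from hz') h
  obtain ⟨rfl, h2⟩ := Sigma.mk.inj_iff.1 key
  obtain ⟨rfl, rfl⟩ := Prod.ext_iff.1 (eq_of_heq h2)
  exact ⟨rfl, rfl⟩

lemma lt_of_map_eq_map_interior {n m : ℕ} {e : C.Cell n} {e' : C.Cell m} {z : UnitDisc n}
    {z' : UnitDisc m} (hz' : ‖z'.1‖ < 1) (h : C.map e z = C.map e' z') : m ≤ n := by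
  by_contra! hlt
  exact C.map_notMem e' z' hz' (h ▸ C.skelLT_mono hlt (C.map_mem e z))

lemma cell_eq {n m : ℕ} {e : C.Cell n} {e' : C.Cell m} {z : UnitDisc n} {z' : UnitDisc m}
    (hz : ‖z.1‖ < 1) (hz' : ‖z'.1‖ < 1) (h : C.map e z = C.map e' z') :
    (⟨n, e⟩ : Σ n, C.Cell n) = ⟨m, e'⟩ := by
  obtain rfl : n = m :=
    le_antisymm (C.lt_of_map_eq_map_interior hz h.symm) (C.lt_of_map_eq_map_interior hz' h)
  rw [(C.map_inj hz hz' h).1]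

lemma isClosed_of_preimage {n : ℕ} {A : Set X} (hA : A ⊆ C.skelLT n)
    (h : ∀ m < n, ∀ e : C.Cell m, IsClosed (C.map e ⁻¹' A)) : IsClosed A := by
  induction n generalizing A with
  | zero =>
    rw [C.skelLT_zero, subset_empty_iff] at hA
    exact hA ▸ isClosed_empty
  | succ n ih =>
    refine (C.isClosed_iff n A hA).2 ⟨ih inter_subset_right fun m hm e => ?_,
      fun i c => h n n.lt_succ_self ⟨i, c⟩⟩
    convert h m (hm.trans n.lt_succ_self) e using 1
    ext z
    exact and_iff_left (C.skelLT_mono hm (C.map_mem e z))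

lemma isClosed_skelLT (n : ℕ) : IsClosed (C.skelLT n) :=
  C.isClosed_of_preimage le_rfl fun m hm e => by
    rw [show C.map e ⁻¹' C.skelLT n = univ from
      eq_univ_of_forall fun z => C.skelLT_mono hm (C.map_mem e z)]
    exact isClosed_univ

/-- A set meeting every open cell in at most one point is closed. -/
lemma isClosed_of_subsingleton {n : ℕ} {A : Set X} (hA : A ⊆ C.skelLT n)
    (h : ∀ m, ∀ e : C.Cell m, {z | ‖z.1‖ < 1 ∧ C.map e z ∈ A}.Subsingleton) : IsClosed A := by
  induction n generalizing A with
  | zero =>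
    rw [C.skelLT_zero, subset_empty_iff] at hA
    exact hA ▸ isClosed_empty
  | succ n ih =>
    have h1 : IsClosed (A ∩ C.skelLT n) :=
      ih inter_subset_right fun m e => (h m e).anti fun z hz => ⟨hz.1, hz.2.1⟩
    refine (C.isClosed_iff n A hA).2 ⟨h1, fun i c => ?_⟩
    -- The open cell contributes at most one point; the boundary sphere lands in the lower skeleton,
    -- where closedness is known by induction.
    have : C.charMap n i c ⁻¹' A =
        {z | ‖z.1‖ < 1 ∧ C.map (⟨i, c⟩ : C.Cell n) z ∈ A} ∪
          C.map (⟨i, c⟩ : C.Cell n) ⁻¹' (A ∩ C.skelLT n) := by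
      ext z
      refine ⟨fun hz => ?_, fun hz => hz.elim (fun h => h.2) (fun h => h.1)⟩
      exact z.norm_lt_or_eq.imp (fun h => ⟨h, hz⟩) fun h => ⟨hz, C.map_mem_of_norm_eq ⟨i, c⟩ z h⟩
    rw [this]
    exact (h n ⟨i, c⟩).isClosed.union (h1.preimage (C.continuous_map _))

/-- A closed cell meets only finitely many open cells. -/
lemma finite_cells_meeting {n : ℕ} (e : C.Cell n) :
    {e' : Σ m, C.Cell m | ∃ z z', ‖z'.1‖ < 1 ∧ C.map e z = C.map e'.2 z'}.Finite := by
  set S := {e' : Σ m, C.Cell m | ∃ z z', ‖z'.1‖ < 1 ∧ C.map e z = C.map e'.2 z'} with hS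
  -- Pick one point in each open cell that is met. Every set of such points is closed, so together
  -- they form a compact discrete space, which is finite.
  choose z z' hz' h using fun e' : S => e'.2
  let p : S → X := fun e' => C.map e'.1.2 (z' e')
  have hp : Function.Injective p := fun a b hab =>
    Subtype.ext (C.cell_eq (hz' a) (hz' b) hab)
  have hsub : ∀ A ⊆ range p, IsClosed A := fun A hA => by
    refine C.isClosed_of_subsingleton (n := n + 1) (fun x hx => ?_) fun m e' a ha b hb => ?_
    · obtain ⟨e', rfl⟩ := hA hx
      have := C.map_mem e (z e')
      rwa [h e'] at this
    · obtain ⟨⟨s, hs⟩, ⟨t, ht⟩⟩ := And.intro (hA ha.2) (hA hb.2)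
      have h1 := C.cell_eq (hz' s) ha.1 hs
      have h2 := C.cell_eq (hz' t) hb.1 ht
      obtain rfl : s = t := Subtype.ext (h1.trans h2.symm)
      exact (C.map_inj ha.1 hb.1 (hs.symm.trans ht)).2
  have hc : IsCompact (range p) := by
    refine (isCompact_range (C.continuous_map e)).of_isClosed_subset (hsub _ le_rfl) ?_
    rintro _ ⟨e', rfl⟩
    exact ⟨z e', h e'⟩
  have hd : DiscreteTopology (range p) := discreteTopology_iff_forall_isClosed.2 fun s => by
    rw [← preimage_image_eq s Subtype.val_injective]
    exact (hsub _ (Subtype.coe_image_subset _ _)).preimage continuous_subtype_val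
  have := (finite_range_iff hp).1 (hc.finite ⟨hd⟩)
  exact S.toFinite

/-- The product of a skeleton with a locally compact space carries the weak topology. -/
lemma isClosed_prod_of_preimage {L : Type w} [TopologicalSpace L] [LocallyCompactSpace L] {n : ℕ}
    {B : Set (X × L)} (hB : ∀ p ∈ B, p.1 ∈ C.skelLT n)
    (h : ∀ m < n, ∀ e : C.Cell m, IsClosed {p : UnitDisc m × L | (C.map e p.1, p.2) ∈ B}) :
    IsClosed B := by
  have hslice : ∀ x : C.skelLT n, IsClosed {a : L | (x.1, a) ∈ B} := fun x => by
    obtain ⟨m, hm, e, z, -, hz⟩ := C.exists_interior_of_mem_skelLT x.2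
    have := (h m hm e).preimage (Continuous.prodMk_right (Y := L) z)
    simpa only [preimage_ofPred_eq, hz] using this
  -- With the Sierpiński topology on `Prop`, `B` becomes a map from the skeleton to a function
  -- space. Currying makes it continuous on each cell, hence on the skeleton; local compactness of
  -- `L` then permits uncurrying.
  let f : C.skelLT n → C(L, Prop) := fun x =>
    ⟨fun a => (x.1, a) ∉ B, continuous_Prop.2 (hslice x).isOpen_compl⟩
  have hf : Continuous f := by
    refine continuous_iff_isClosed.2 fun D hD => ?_
    have hcl : IsClosed (Subtype.val '' (f ⁻¹' D)) := by
      refine C.isClosed_of_preimage (n := n) (Subtype.coe_image_subset _ _) fun m hm e => ?_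
      have hmem : ∀ z, C.map e z ∈ C.skelLT n := fun z => C.skelLT_mono hm (C.map_mem e z)
      have hcont : Continuous fun z : UnitDisc m => f ⟨C.map e z, hmem z⟩ :=
        ContinuousMap.continuous_of_continuous_uncurry _
          (continuous_Prop.2 (h m hm e).isOpen_compl)
      convert hD.preimage hcont using 1
      ext z
      simp [hmem z]
    rw [← preimage_image_eq (f ⁻¹' D) Subtype.val_injective]
    exact hcl.preimage continuous_subtype_val
  have h2 : IsClosed {p : C.skelLT n × L | (p.1.1, p.2) ∈ B} := by
    have := continuous_Prop.1 (ContinuousMap.continuous_uncurry_of_continuous ⟨f, hf⟩)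
    rw [← isOpen_compl_iff]
    exact this
  have h3 := ((C.isClosed_skelLT n).isClosedEmbedding_subtypeVal.prodMap
    (Topology.IsClosedEmbedding.id (X := L))).isClosedMap _ h2
  convert h3 using 1
  ext ⟨x, a⟩
  simp only [mem_image, mem_ofPred_eq, Prod.exists, Prod.map_apply, id_eq, Prod.mk.injEq,
    Subtype.exists]
  exact ⟨fun hp => ⟨x, hB _ hp, a, hp, rfl, rfl⟩, by rintro ⟨x, -, a, hp, rfl, rfl⟩; exact hp⟩

lemma continuousOn_prod_of_cells {L : Type w} [TopologicalSpace L] [LocallyCompactSpace L]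
    {Z : Type*} [TopologicalSpace Z] {n : ℕ} {f : X × L → Z}
    (h : ∀ m < n, ∀ e : C.Cell m, Continuous fun p : UnitDisc m × L => f (C.map e p.1, p.2)) :
    ContinuousOn f {p | p.1 ∈ C.skelLT n} := by
  refine continuousOn_iff_isClosed.2 fun A hA =>
    ⟨f ⁻¹' A ∩ {p | p.1 ∈ C.skelLT n}, ?_, by rw [inter_assoc, inter_self]⟩
  refine C.isClosed_prod_of_preimage (fun p hp => hp.2) fun m hm e => ?_
  convert hA.preimage (h m hm e) using 1
  ext p
  exact and_iff_left (C.skelLT_mono hm (C.map_mem e p.1))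

lemma FiniteDimensional.exists_skelLT_eq_univ {C : GComplex G X} (hC : C.FiniteDimensional) :
    ∃ N, C.skelLT N = univ := by
  obtain ⟨N, hN⟩ := hC
  refine ⟨N + 1, eq_univ_of_forall fun x => ?_⟩
  obtain ⟨m, e, z, -, rfl⟩ := C.exists_interior x
  refine C.skelLT_mono ?_ (C.map_mem e z)
  by_contra! hlt
  exact (hN m (by omega)).false e.1

/-- A `G`-complex structure from `G`-sets of cells. -/
noncomputable def ofCells (E : ℕ → Type v) [∀ n, MulAction G (E n)]
    (Φ : ∀ n, E n → UnitDisc n → X) (S : ℕ → Set X)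
    (map_smul : ∀ n (g : G) (e : E n) z, Φ n (g • e) z = g • Φ n e z)
    (continuous_map : ∀ n e, Continuous (Φ n e))
    (zero : S 0 = ∅)
    (succ : ∀ n, S (n + 1) = S n ∪ ⋃ e : E n, range (Φ n e))
    (map_mem : ∀ n e (z : UnitDisc n), ‖z.1‖ = 1 → Φ n e z ∈ S n)
    (map_notMem : ∀ n e (z : UnitDisc n), ‖z.1‖ < 1 → Φ n e z ∉ S n)
    (map_inj : ∀ n e e' (z z' : UnitDisc n), ‖z.1‖ < 1 → ‖z'.1‖ < 1 → Φ n e z = Φ n e' z' →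
      e = e' ∧ z = z')
    (isClosed_iff : ∀ (n : ℕ) (A : Set X), A ⊆ S (n + 1) →
      (IsClosed A ↔ IsClosed (A ∩ S n) ∧ ∀ e : E n, IsClosed (Φ n e ⁻¹' A)))
    (iUnion : ⋃ n, S n = univ)
    (isClosed_of : ∀ A : Set X, (∀ n, IsClosed (A ∩ S n)) → IsClosed A) : GComplex G X :=
  -- An orbit of cells is identified with `G` modulo the stabilizer of a chosen representative.
  have surj : ∀ n (e : E n), ∃ (i : MulAction.orbitRel.Quotient G (E n))
      (c : G ⧸ MulAction.stabilizer G i.out), MulAction.ofQuotientStabilizer G i.out c = e := by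
    intro n e
    obtain ⟨g, hg⟩ := MulAction.orbitRel_apply.1
      (Quotient.exact (Quotient.out_eq (Quotient.mk (MulAction.orbitRel G (E n)) e)).symm)
    exact ⟨Quotient.mk _ e, (g : G), hg⟩
  { cell := fun n => MulAction.orbitRel.Quotient G (E n)
    stab := fun n i => MulAction.stabilizer G i.out
    charMap := fun n i c z => Φ n (MulAction.ofQuotientStabilizer G i.out c) z
    skelLT := S
    charMap_smul := fun n i g c z => by rw [MulAction.ofQuotientStabilizer_smul, map_smul]
    continuous_charMap := fun n i c => continuous_map n _
    skelLT_zero := zero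
    skelLT_succ := fun n => by
      rw [succ]
      congr 1
      ext x
      simp only [mem_iUnion]
      constructor
      · rintro ⟨e, z, rfl⟩
        obtain ⟨i, c, rfl⟩ := surj n e
        exact ⟨i, c, z, rfl⟩
      · rintro ⟨i, c, z, rfl⟩
        exact ⟨_, z, rfl⟩
    charMap_mem := fun n i c z => map_mem n _ z
    charMap_notMem := fun n i c z => map_notMem n _ z
    charMap_injOn := by
      rintro n ⟨i, c, z⟩ hz ⟨i', c', z'⟩ hz' h
      obtain ⟨h1, rfl⟩ := map_inj n _ _ z z' hz hz' h
      obtain rfl : i = i' := by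
        induction c using QuotientGroup.induction_on with | H g => ?_
        induction c' using QuotientGroup.induction_on with | H g' => ?_
        simp only [MulAction.ofQuotientStabilizer_mk] at h1
        rw [← Quotient.out_eq i, ← Quotient.out_eq i']
        refine Quotient.sound (MulAction.orbitRel_apply.2 ⟨g⁻¹ * g', ?_⟩)
        simp only [mul_smul, ← h1, inv_smul_smul]
      obtain rfl : c = c' := MulAction.injective_ofQuotientStabilizer G _ h1
      rfl
    isClosed_iff := fun n A hA => by
      rw [isClosed_iff n A hA]
      refine and_congr_right fun _ => ⟨fun h i c => h _, fun h e => ?_⟩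
      obtain ⟨i, c, rfl⟩ := surj n e
      exact h i c
    iUnion_skelLT := iUnion
    isClosed_of_skelLT := isClosed_of }

end GComplex

/-! ### Labellings and the thickening -/

namespace GComplex

variable {G : Type u} [Group G] {X : Type v} [TopologicalSpace X] [MulAction G X]
  [ContinuousConstSMul G X]

/-- Increasing sequences of equivalence relations on a `G`-set `W`, one for each point of a
`G`-complex, which are constant on open cells, coarser on the boundary of a cell than on the cell,
and exhaust `W × W` at each point. -/
structure Labelling (C : GComplex G X) (W : Type w) [MulAction G W] where
  rel : X → ℕ → Setoid W
  mono : ∀ {x : X} {k l : ℕ} {a b : W}, k ≤ l → rel x k a b → rel x l a b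
  rel_of_interior : ∀ {n : ℕ} (e : C.Cell n) {z : UnitDisc n} (z' : UnitDisc n) {k : ℕ} {a b : W},
    ‖z.1‖ < 1 → rel (C.map e z) k a b → rel (C.map e z') k a b
  exists_rel : ∀ (x : X) (a b : W), ∃ k, rel x k a b
  smul_rel : ∀ (g : G) {x : X} {k : ℕ} {a b : W}, rel x k a b → rel (g • x) k (g • a) (g • b)

namespace Labelling

variable {C : GComplex G X} {W : Type w} [MulAction G W] (L : Labelling C W)

/-- Points at height `t` over `x` are identified if their labels are related at level `⌊t⌋`. -/
def pointSetoid : Setoid (Σ _ : W, X × ℝ≥0) where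
  -- The floor makes level `k` govern heights in `[k, k+1)`, with the coarser relation already in
  -- force at `k+1`: the target end of a mapping cylinder.
  r p q := p.2 = q.2 ∧ L.rel p.2.1 ⌊p.2.2⌋₊ p.1 q.1
  iseqv :=
    { refl := fun _ => ⟨rfl, (L.rel _ _).refl _⟩
      symm := fun h => ⟨h.1.symm, h.1 ▸ (L.rel _ _).symm h.2⟩
      trans := fun h h' => ⟨h.1.trans h'.1, (L.rel _ _).trans h.2 (h.1 ▸ h'.2)⟩ }

/-- The thickening of a `G`-complex by a labelling: a mapping telescope of the quotients of
`X × W`. -/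
def Thickening : Type (max v w) := Quotient L.pointSetoid

instance : TopologicalSpace L.Thickening :=
  inferInstanceAs (TopologicalSpace (Quotient L.pointSetoid))

namespace Thickening

/-- The point at height `t` over `x` with label `a`. -/
def point (x : X) (t : ℝ≥0) (a : W) : L.Thickening := Quotient.mk L.pointSetoid ⟨a, x, t⟩

variable {L}

lemma point_eq_point {x x' : X} {t t' : ℝ≥0} {a a' : W} :
    point L x t a = point L x' t' a' ↔ x = x' ∧ t = t' ∧ L.rel x ⌊t⌋₊ a a' := by
  refine (Quotient.eq (r := L.pointSetoid)).trans ?_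
  change (x, t) = (x', t') ∧ _ ↔ _
  rw [Prod.mk.injEq, and_assoc]

lemma point_eq {x : X} {t : ℝ≥0} {a a' : W} (h : L.rel x ⌊t⌋₊ a a') : point L x t a = point L x t a' :=
  point_eq_point.2 ⟨rfl, rfl, h⟩

lemma exists_point (y : L.Thickening) : ∃ x t a, point L x t a = y := by
  obtain ⟨⟨a, x, t⟩, rfl⟩ := Quotient.exists_rep y
  exact ⟨x, t, a, rfl⟩

lemma continuous_point (a : W) : Continuous fun p : X × ℝ≥0 => point L p.1 p.2 a :=
  continuous_quotient_mk'.comp (continuous_sigmaMk (σ := fun _ : W => X × ℝ≥0))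

lemma isClosed_iff {A : Set L.Thickening} :
    IsClosed A ↔ ∀ a, IsClosed {p : X × ℝ≥0 | point L p.1 p.2 a ∈ A} := by
  refine (isQuotientMap_quotient_mk' (s := L.pointSetoid)).isClosed_preimage.symm.trans ?_
  exact isClosed_sigma_iff (σ := fun _ : W => X × ℝ≥0)

lemma continuous_of_point {Z : Type*} [TopologicalSpace Z] {f : L.Thickening → Z}
    (h : ∀ a, Continuous fun p : X × ℝ≥0 => f (point L p.1 p.2 a)) : Continuous f :=
  continuous_iff_isClosed.2 fun _ hA => isClosed_iff.2 fun a => hA.preimage (h a)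

/-- Descend a function to the thickening. -/
def lift {Z : Type*} (f : X → ℝ≥0 → W → Z)
    (h : ∀ x t a b, L.rel x ⌊t⌋₊ a b → f x t a = f x t b) : L.Thickening → Z :=
  Quotient.lift (fun p : Σ _ : W, X × ℝ≥0 => f p.2.1 p.2.2 p.1) <| by
    rintro ⟨a, x, t⟩ ⟨b, x', t'⟩ ⟨h1, h2⟩
    obtain ⟨rfl, rfl⟩ := Prod.ext_iff.1 h1
    exact h _ _ _ _ h2

variable (L) in
/-- The projection from the thickening. -/
def proj : C(L.Thickening, X) where
  toFun := lift (fun x _ _ => x) fun _ _ _ _ _ => rfl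
  continuous_toFun := continuous_of_point fun _ => continuous_fst

variable (L) in
/-- The height of a point of the thickening. -/
def height : C(L.Thickening, ℝ≥0) where
  toFun := lift (fun _ t _ => t) fun _ _ _ _ _ => rfl
  continuous_toFun := continuous_of_point fun _ => continuous_snd

@[simp] lemma height_point (x : X) (t : ℝ≥0) (a : W) : height L (point L x t a) = t := rfl

instance : MulAction G L.Thickening where
  smul g := lift (fun x t a => point L (g • x) t (g • a)) fun _ _ _ _ h => point_eq (L.smul_rel g h)
  one_smul y := by
    obtain ⟨x, t, a, rfl⟩ := exists_point y
    change point L ((1 : G) • x) t ((1 : G) • a) = _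
    rw [one_smul, one_smul]
  mul_smul g h y := by
    obtain ⟨x, t, a, rfl⟩ := exists_point y
    change point L ((g * h) • x) t ((g * h) • a) = point L (g • h • x) t (g • h • a)
    rw [mul_smul, mul_smul]

lemma smul_point (g : G) (x : X) (t : ℝ≥0) (a : W) :
    g • point L x t a = point L (g • x) t (g • a) := rfl

instance : ContinuousConstSMul G L.Thickening where
  continuous_const_smul g := continuous_of_point fun a =>
    (continuous_point (g • a)).comp (((continuous_const_smul g).comp continuous_fst).prodMk
      continuous_snd)

lemma proj_smul (g : G) (y : L.Thickening) : proj L (g • y) = g • proj L y := by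
  obtain ⟨x, t, a, rfl⟩ := exists_point y
  rfl

end Thickening

end Labelling

end GComplex

/-! ### Contractibility of the thickening -/

/-- The nearest-point retraction onto the unit disc. -/
noncomputable def UnitDisc.retract {n : ℕ} (w : EuclideanSpace ℝ (Fin n)) : UnitDisc n :=
  ⟨(max 1 ‖w‖)⁻¹ • w, by
    have h : 0 < max 1 ‖w‖ := lt_max_of_lt_left one_pos
    rw [mem_closedBall_zero_iff, norm_smul, norm_inv, Real.norm_of_nonneg h.le, inv_mul_le_iff₀ h,
      mul_one]
    exact le_max_right _ _⟩

namespace UnitDisc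

lemma continuous_retract (n : ℕ) : Continuous (retract (n := n)) := by
  refine Continuous.subtype_mk (Continuous.smul ((continuous_const.max continuous_norm).inv₀ fun w => ?_)
    continuous_id) _
  exact (lt_max_of_lt_left one_pos).ne'

lemma norm_retract {n : ℕ} {w : EuclideanSpace ℝ (Fin n)} (h : 1 ≤ ‖w‖) : ‖(retract w).1‖ = 1 := by
  have h0 : 0 < ‖w‖ := one_pos.trans_le h
  simp [retract, max_eq_right h, norm_smul, h0.ne']

lemma retract_eq {n : ℕ} {w : EuclideanSpace ℝ (Fin n)} (h : ‖w‖ ≤ 1) : (retract w).1 = w := by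
  simp [retract, max_eq_left h]

lemma retract_smul {n : ℕ} {z : UnitDisc n} (hz : ‖z.1‖ = 1) {r : ℝ} (hr : 1 ≤ r) :
    retract (r • z.1) = z := by
  have h0 : 0 < r := one_pos.trans_le hr
  apply Subtype.ext
  simp only [retract, norm_smul, hz, mul_one, Real.norm_of_nonneg h0.le, max_eq_right hr, smul_smul,
    inv_mul_cancel₀ h0.ne', one_smul]

end UnitDisc

namespace GComplex.Labelling

variable {G : Type u} [Group G] {X : Type v} [TopologicalSpace X] [MulAction G X]
  [ContinuousConstSMul G X] {C : GComplex G X} {W : Type w} [MulAction G W] (L : Labelling C W)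

open Thickening

/-- `K` deforms the part of the thickening over the skeleton `skelLT n` in time `2 * n` so that
the final position of a point depends on its projection only. -/
structure IsDeformation (a₀ : W) (n : ℕ) (K : X → ℝ≥0 → W → ℝ≥0 → L.Thickening) : Prop where
  continuous : ∀ m < n, ∀ (e : C.Cell m) (a : W),
    Continuous fun p : UnitDisc m × (ℝ≥0 × ℝ≥0) => K (C.map e p.1) p.2.1 a p.2.2
  congr : ∀ x ∈ C.skelLT n, ∀ t a b s, L.rel x ⌊t⌋₊ a b → K x t a s = K x t b s
  zero : ∀ x ∈ C.skelLT n, ∀ t a, K x t a 0 = point L x t a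
  -- From time `2 * n` on, `K` is stationary and forgets height and label. Height and label can then
  -- be altered over the `n`-cells without disturbing their boundaries.
  final : ∀ x ∈ C.skelLT n, ∀ t a (s : ℝ≥0), 2 * n ≤ s → K x t a s = K x 0 a₀ (2 * n)

/-- Push a cell radially into its boundary, and follow `K` from there. -/
noncomputable def push (K : X → ℝ≥0 → W → ℝ≥0 → L.Thickening) {n : ℕ} (e : C.Cell n)
    (z : UnitDisc n) (t : ℝ≥0) (a : W) (s : ℝ≥0) : L.Thickening :=
  -- The excess of the norm over `1` is the time spent following `K`: all of `s` for a boundary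
  -- point, none for the center.
  if ‖(1 + s : ℝ) • z.1‖ ≤ 1 then point L (C.map e (UnitDisc.retract ((1 + s : ℝ) • z.1))) t a
  else K (C.map e (UnitDisc.retract ((1 + s : ℝ) • z.1))) t a (‖(1 + s : ℝ) • z.1‖ - 1).toNNReal

/-- The level at which a label becomes related to the base label on a cell. -/
noncomputable def level (a₀ : W) {n : ℕ} (e : C.Cell n) (a : W) : ℕ :=
  sInf {k | L.rel (C.map e (UnitDisc.center n)) k a a₀}

lemma rel_of_level_le (a₀ : W) {n : ℕ} (e : C.Cell n) (a : W) {k : ℕ} (h : L.level a₀ e a ≤ k) :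
    L.rel (C.map e (UnitDisc.center n)) k a a₀ :=
  L.mono h (Nat.sInf_mem (s := {k | L.rel (C.map e (UnitDisc.center n)) k a a₀})
    (L.exists_rel (C.map e (UnitDisc.center n)) a a₀))

lemma level_le (a₀ : W) {n : ℕ} (e : C.Cell n) {a : W} {k : ℕ}
    (h : L.rel (C.map e (UnitDisc.center n)) k a a₀) : L.level a₀ e a ≤ k := Nat.sInf_le h

/-- Labels related at level `⌊t⌋₊` either have the same level or both have level at most `⌊t⌋₊`; the
maximum with `t` hides the second case. Hence the height to which a point is raised is well defined
on the quotient. -/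
lemma max_level_congr (a₀ : W) {n : ℕ} (e : C.Cell n) {t : ℝ≥0} {a b : W}
    (h : L.rel (C.map e (UnitDisc.center n)) ⌊t⌋₊ a b) :
    max t (L.level a₀ e a) = max t (L.level a₀ e b) := by
  have key : ∀ {a b : W}, L.rel (C.map e (UnitDisc.center n)) ⌊t⌋₊ a b →
      max t (L.level a₀ e a) ≤ max t (L.level a₀ e b) := fun {a b} h => by
    refine max_le (le_max_left _ _) ?_
    rcases le_total (L.level a₀ e b) ⌊t⌋₊ with h' | h'
    · refine le_max_of_le_left ((Nat.cast_le.2 (L.level_le a₀ e ?_)).trans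
        (Nat.floor_le zero_le))
      exact (L.rel _ _).trans h (L.rel_of_level_le a₀ e b h')
    · refine le_max_of_le_right (Nat.cast_le.2 (L.level_le a₀ e ?_))
      exact (L.rel _ _).trans (L.mono h' h) (L.rel_of_level_le a₀ e b le_rfl)
  exact le_antisymm (key h) (key ((L.rel _ _).symm h))

variable {L} {a₀ : W} {n : ℕ} {K : X → ℝ≥0 → W → ℝ≥0 → L.Thickening}

lemma IsDeformation.continuousOn (hK : L.IsDeformation a₀ n K) (a : W) :
    ContinuousOn (fun p : X × (ℝ≥0 × ℝ≥0) => K p.1 p.2.1 a p.2.2) {p | p.1 ∈ C.skelLT n} :=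
  C.continuousOn_prod_of_cells fun m hm e => hK.continuous m hm e a

lemma IsDeformation.push_congr (hK : L.IsDeformation a₀ n K) (e : C.Cell n) (z : UnitDisc n)
    {t : ℝ≥0} {a b : W} (s : ℝ≥0) (h : L.rel (C.map e (UnitDisc.center n)) ⌊t⌋₊ a b) :
    L.push K e z t a s = L.push K e z t b s := by
  have h' := L.rel_of_interior e (UnitDisc.retract ((1 + s : ℝ) • z.1)) (UnitDisc.norm_center_lt n) h
  unfold push
  split_ifs with hw
  · exact point_eq h'
  · exact hK.congr _ (C.map_mem_of_norm_eq _ _ (UnitDisc.norm_retract (not_le.1 hw).le)) _ _ _ _ h'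

lemma push_zero (e : C.Cell n) (z : UnitDisc n) (t : ℝ≥0) (a : W) :
    L.push K e z t a 0 = point L (C.map e z) t a := by
  have hz := mem_closedBall_zero_iff.1 z.2
  have : UnitDisc.retract z.1 = z := Subtype.ext (UnitDisc.retract_eq hz)
  simp [push, hz, this]

lemma IsDeformation.push_boundary (hK : L.IsDeformation a₀ n K) (e : C.Cell n) {z : UnitDisc n}
    (hz : ‖z.1‖ = 1) (t : ℝ≥0) (a : W) (s : ℝ≥0) :
    L.push K e z t a s = K (C.map e z) t a s := by
  have hs : (1 : ℝ) ≤ 1 + s := le_add_of_nonneg_right s.2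
  have hn : ‖(1 + s : ℝ) • z.1‖ = 1 + s := by
    rw [norm_smul, hz, mul_one, Real.norm_of_nonneg (zero_le_one.trans hs)]
  unfold push
  rw [hn, UnitDisc.retract_smul hz hs]
  split_ifs with h
  · obtain rfl : s = 0 := le_antisymm (NNReal.coe_le_coe.1 (by simpa using h)) zero_le
    exact (hK.zero _ (C.map_mem_of_norm_eq e z hz) t a).symm
  · simp

lemma IsDeformation.continuous_push (hK : L.IsDeformation a₀ n K) (e : C.Cell n) (a : W) :
    Continuous fun p : UnitDisc n × (ℝ≥0 × ℝ≥0) => L.push K e p.1 p.2.1 a p.2.2 := by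
  have hw : Continuous fun p : UnitDisc n × (ℝ≥0 × ℝ≥0) => (1 + p.2.2 : ℝ) • p.1.1 := by fun_prop
  have hr : Continuous fun p : UnitDisc n × (ℝ≥0 × ℝ≥0) =>
      C.map e (UnitDisc.retract ((1 + p.2.2 : ℝ) • p.1.1)) :=
    (C.continuous_map e).comp ((UnitDisc.continuous_retract n).comp hw)
  have ht : Continuous fun p : UnitDisc n × (ℝ≥0 × ℝ≥0) => p.2.1 := by fun_prop
  refine continuous_if_le hw.norm continuous_const ?_ ?_ fun p hp => ?_
  · exact ((continuous_point a).comp (hr.prodMk ht)).continuousOn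
  · exact (hK.continuousOn a).comp (t := {p | p.1 ∈ C.skelLT n})
      (f := fun p : UnitDisc n × (ℝ≥0 × ℝ≥0) =>
        (C.map e (UnitDisc.retract ((1 + p.2.2 : ℝ) • p.1.1)),
          (p.2.1, (‖(1 + p.2.2 : ℝ) • p.1.1‖ - 1).toNNReal)))
      (hr.prodMk (ht.prodMk
        (continuous_real_toNNReal.comp (hw.norm.sub continuous_const)))).continuousOn
      fun p hp => C.map_mem_of_norm_eq _ _ (UnitDisc.norm_retract hp)
  · rw [hp, sub_self, Real.toNNReal_zero,
      hK.zero _ (C.map_mem_of_norm_eq _ _ (UnitDisc.norm_retract hp.ge))]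

lemma IsDeformation.continuous_push_comp (hK : L.IsDeformation a₀ n K) (e : C.Cell n) (a : W)
    {Z : Type*} [TopologicalSpace Z] {f : Z → UnitDisc n} {t s : Z → ℝ≥0} (hf : Continuous f)
    (ht : Continuous t) (hs : Continuous s) :
    Continuous fun p => L.push K e (f p) (t p) a (s p) := by
  have h := (hK.continuous_push e a).comp (hf.prodMk (ht.prodMk hs))
  simpa only [Function.comp_def] using h

/-- The deformation over an `n`-cell: push radially during time `2 * n`, then raise the height
until the label may be exchanged for the base label, and finally lower the height to `0`. -/
noncomputable def cellDeformation (a₀ : W) (K : X → ℝ≥0 → W → ℝ≥0 → L.Thickening) {n : ℕ}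
    (e : C.Cell n) (z : UnitDisc n) (t : ℝ≥0) (a : W) (s : ℝ≥0) : L.Thickening :=
  -- Subtraction is truncated: `s - 2 * n` vanishes during the radial push, and `2 - (s - 2 * n)`
  -- vanishes from time `2 * n + 2` on.
  if s - 2 * n ≤ 1 then
    L.push K e z (t + (s - 2 * n) * (max t (L.level a₀ e a) - t)) a (min s (2 * n))
  else L.push K e z (max t (L.level a₀ e a) * (2 - (s - 2 * n))) a₀ (min s (2 * n))

lemma IsDeformation.continuous_cellDeformation (hK : L.IsDeformation a₀ n K) (e : C.Cell n)
    (a : W) : Continuous fun p : UnitDisc n × (ℝ≥0 × ℝ≥0) =>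
      cellDeformation a₀ K e p.1 p.2.1 a p.2.2 := by
  refine continuous_if_le (by fun_prop) continuous_const (Continuous.continuousOn ?_)
    (Continuous.continuousOn ?_) fun p hp => ?_
  · exact hK.continuous_push_comp e a continuous_fst (by fun_prop) (by fun_prop)
  · exact hK.continuous_push_comp e a₀ continuous_fst (by fun_prop) (by fun_prop)
  · have h2 : (2 - 1 : ℝ≥0) = 1 := by
      rw [← one_add_one_eq_two, add_tsub_cancel_right]
    rw [hp, one_mul, add_tsub_cancel_of_le (le_max_left _ _), h2, mul_one]
    -- At time `2 * n + 1` the height is at least the level of `a`, so `a` and `a₀` are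
    -- interchangeable over the whole closed cell and the two branches agree.
    exact hK.push_congr e _ _ (L.rel_of_level_le a₀ e a (Nat.le_floor (le_max_right _ _)))

/-- Raising and lowering happen after time `2 * n`, when `K` on the boundary no longer sees height
or label. This lets the deformations of all `n`-cells glue to `K`. -/
lemma IsDeformation.cellDeformation_boundary (hK : L.IsDeformation a₀ n K) (e : C.Cell n)
    {z : UnitDisc n} (hz : ‖z.1‖ = 1) (t : ℝ≥0) (a : W) (s : ℝ≥0) :
    cellDeformation a₀ K e z t a s = K (C.map e z) t a s := by
  have hmem := C.map_mem_of_norm_eq e z hz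
  unfold cellDeformation
  rw [hK.push_boundary e hz, hK.push_boundary e hz]
  rcases le_total s (2 * n) with hs | hs
  · rw [tsub_eq_zero_of_le hs, if_pos zero_le_one, zero_mul, add_zero, min_eq_left hs]
  · rw [min_eq_right hs, hK.final _ hmem _ _ _ le_rfl,
      hK.final _ hmem (max t (L.level a₀ e a) * (2 - (s - 2 * n))) _ _ le_rfl, ite_self,
      hK.final _ hmem _ _ _ hs]

lemma cellDeformation_zero (e : C.Cell n) (z : UnitDisc n) (t : ℝ≥0) (a : W) :
    cellDeformation a₀ K e z t a 0 = point L (C.map e z) t a := by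
  unfold cellDeformation
  rw [zero_tsub, if_pos zero_le_one, zero_mul, add_zero, min_eq_left zero_le, push_zero]

lemma IsDeformation.cellDeformation_congr (hK : L.IsDeformation a₀ n K) (e : C.Cell n)
    (z : UnitDisc n) {t : ℝ≥0} {a b : W} (s : ℝ≥0)
    (h : L.rel (C.map e (UnitDisc.center n)) ⌊t⌋₊ a b) :
    cellDeformation a₀ K e z t a s = cellDeformation a₀ K e z t b s := by
  unfold cellDeformation
  rw [L.max_level_congr a₀ e h]
  congr 1
  exact hK.push_congr e _ _ (L.mono (Nat.floor_mono le_self_add) h)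

lemma cellDeformation_final (e : C.Cell n) (z : UnitDisc n) (t : ℝ≥0) (a : W) {s : ℝ≥0}
    (hs : 2 * (n + 1 : ℕ) ≤ s) :
    cellDeformation a₀ K e z t a s = L.push K e z 0 a₀ (2 * n) := by
  have h2 : 2 ≤ s - 2 * n := le_tsub_of_add_le_left (by push_cast at hs; linarith)
  have hn : 2 * n ≤ s := le_trans (by push_cast; linarith) hs
  unfold cellDeformation
  rw [if_neg (not_le.2 (one_lt_two.trans_le h2)), tsub_eq_zero_of_le h2, mul_zero,
    min_eq_right hn]

open Classical in
/-- Extend a deformation over the `n`-cells. -/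
noncomputable def extendDeformation (a₀ : W) (n : ℕ) (K : X → ℝ≥0 → W → ℝ≥0 → L.Thickening)
    (x : X) (t : ℝ≥0) (a : W) (s : ℝ≥0) : L.Thickening :=
  if h : ∃ (e : C.Cell n) (z : UnitDisc n), ‖z.1‖ < 1 ∧ C.map e z = x then
    cellDeformation a₀ K h.choose h.choose_spec.choose t a s
  else K x t a s

lemma extendDeformation_of_mem {x : X} (hx : x ∈ C.skelLT n) :
    extendDeformation a₀ n K x = K x := by
  funext t a s
  refine dif_neg ?_
  rintro ⟨e, z, hz, rfl⟩
  exact C.map_notMem e z hz hx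

lemma IsDeformation.extendDeformation_map (hK : L.IsDeformation a₀ n K) (e : C.Cell n)
    (z : UnitDisc n) (t : ℝ≥0) (a : W) (s : ℝ≥0) :
    extendDeformation a₀ n K (C.map e z) t a s = cellDeformation a₀ K e z t a s := by
  rcases z.norm_lt_or_eq with hz | hz
  · have h : ∃ (e' : C.Cell n) (z' : UnitDisc n), ‖z'.1‖ < 1 ∧ C.map e' z' = C.map e z :=
      ⟨e, z, hz, rfl⟩
    obtain ⟨h1, h2⟩ := C.map_inj h.choose_spec.choose_spec.1 hz h.choose_spec.choose_spec.2
    unfold extendDeformation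
    rw [dif_pos h, h2, h1]
  · rw [extendDeformation_of_mem (C.map_mem_of_norm_eq e z hz), hK.cellDeformation_boundary e hz]

lemma IsDeformation.extend (hK : L.IsDeformation a₀ n K) :
    L.IsDeformation a₀ (n + 1) (extendDeformation a₀ n K) := by
  have cases_of_mem : ∀ {x}, x ∈ C.skelLT (n + 1) →
      x ∈ C.skelLT n ∨ ∃ (e : C.Cell n) (z : UnitDisc n), ‖z.1‖ < 1 ∧ C.map e z = x := by
    intro x hx
    rcases C.exists_of_mem_skelLT_succ hx with h | ⟨e, z, rfl⟩
    · exact Or.inl h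
    · exact z.norm_lt_or_eq.symm.imp (C.map_mem_of_norm_eq e z) fun h => ⟨e, z, h, rfl⟩
  refine ⟨fun m hm e a => ?_, fun x hx t a b s h => ?_, fun x hx t a => ?_,
    fun x hx t a s hs => ?_⟩
  · rcases (Nat.lt_succ_iff_lt_or_eq.1 hm) with hm | rfl
    · simpa only [extendDeformation_of_mem (C.skelLT_mono hm (C.map_mem e _))] using
        hK.continuous m hm e a
    · simpa only [hK.extendDeformation_map] using hK.continuous_cellDeformation e a
  · rcases cases_of_mem hx with hx | ⟨e, z, hz, rfl⟩
    · rw [extendDeformation_of_mem hx, hK.congr x hx _ _ _ _ h]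
    · rw [hK.extendDeformation_map, hK.extendDeformation_map, hK.cellDeformation_congr]
      exact L.rel_of_interior e _ hz h
  · rcases cases_of_mem hx with hx | ⟨e, z, hz, rfl⟩
    · rw [extendDeformation_of_mem hx, hK.zero x hx]
    · rw [hK.extendDeformation_map, cellDeformation_zero]
  · rcases cases_of_mem hx with hx | ⟨e, z, hz, rfl⟩
    · have hn : 2 * (n : ℝ≥0) ≤ 2 * (n + 1 : ℕ) := by push_cast; linarith
      rw [extendDeformation_of_mem hx, hK.final x hx _ _ _ (hn.trans hs),
        hK.final x hx _ _ _ hn]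
    · rw [hK.extendDeformation_map, hK.extendDeformation_map, cellDeformation_final _ _ _ _ hs,
        cellDeformation_final _ _ _ _ le_rfl]

variable (L) in
lemma exists_isDeformation (a₀ : W) (n : ℕ) : ∃ K, L.IsDeformation a₀ n K := by
  induction n with
  | zero =>
    refine ⟨fun x t a _ => point L x t a, ⟨by simp, ?_, ?_, ?_⟩⟩ <;> simp [C.skelLT_zero]
  | succ n ih =>
    obtain ⟨K, hK⟩ := ih
    exact ⟨_, hK.extend⟩

variable (L) in
-- At time `2 * N` the deformation depends on the projection only, so the identity is homotopic to
-- `sec ∘ proj`, which is nullhomotopic through `X`. The map `sec` need not be a section of `proj`,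
-- since radial pushes move points of `X`.
theorem contractibleSpace_thickening [Nonempty W] (hC : C.FiniteDimensional)
    [ContractibleSpace X] : ContractibleSpace L.Thickening := by
  obtain ⟨N, hN⟩ := hC.exists_skelLT_eq_univ
  let a₀ : W := Classical.arbitrary W
  obtain ⟨K, hK⟩ := L.exists_isDeformation a₀ N
  have hmem : ∀ x, x ∈ C.skelLT N := fun x => hN ▸ mem_univ x
  have hcont : ∀ a, Continuous fun p : X × (ℝ≥0 × ℝ≥0) => K p.1 p.2.1 a p.2.2 := fun a =>
    continuousOn_univ.1 ((hK.continuousOn a).mono fun p _ => hmem p.1)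
  -- Currying time lets the homotopy descend to the quotient, with continuity checked one label at a
  -- time.
  let H : L.Thickening → C(ℝ≥0, L.Thickening) :=
    lift (fun x t a => ⟨fun s => K x t a s, (hcont a).comp
      (by fun_prop : Continuous fun s : ℝ≥0 => (x, (t, s)))⟩) fun x t a b h =>
        ContinuousMap.ext fun s => hK.congr x (hmem x) t a b s h
  have hH : Continuous H := continuous_of_point fun a =>
    ContinuousMap.continuous_of_continuous_uncurry _ ((hcont a).comp
      (by fun_prop : Continuous fun p : (X × ℝ≥0) × ℝ≥0 => (p.1.1, (p.1.2, p.2))))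
  let sec : C(X, L.Thickening) :=
    ⟨fun x => K x 0 a₀ (2 * N), (hcont a₀).comp
      (by fun_prop : Continuous fun x : X => (x, ((0 : ℝ≥0), (2 * N : ℝ≥0))))⟩
  have h1 : (ContinuousMap.id L.Thickening).Homotopic (sec.comp (proj L)) :=
    ⟨{ toFun := fun p => H p.2 (2 * N * unitInterval.toNNReal p.1)
       continuous_toFun := (ContinuousMap.continuous_uncurry_of_continuous ⟨H, hH⟩).comp
         (by fun_prop : Continuous fun p : unitInterval × L.Thickening =>
           (p.2, 2 * (N : ℝ≥0) * unitInterval.toNNReal p.1))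
       map_zero_left := fun y => by
         obtain ⟨x, t, a, rfl⟩ := exists_point y
         change K x t a _ = _
         simpa using hK.zero x (hmem x) t a
       map_one_left := fun y => by
         obtain ⟨x, t, a, rfl⟩ := exists_point y
         change K x t a _ = K x 0 a₀ _
         simpa using hK.final x (hmem x) t a _ le_rfl }⟩
  rw [contractible_iff_id_nullhomotopic]
  obtain ⟨x, hx⟩ := id_nullhomotopic X
  exact ⟨sec x, h1.trans
    (((ContinuousMap.Homotopic.refl sec).comp hx).comp (ContinuousMap.Homotopic.refl (proj L)))⟩

end GComplex.Labelling

/-! ### The cell structure of the thickening -/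

/-- The disc `D^(n+1)` is homeomorphic to the prism `D^n × [0, 1]`. -/
lemma UnitDisc.exists_homeomorph_prism (n : ℕ) :
    ∃ δ : UnitDisc (n + 1) ≃ₜ UnitDisc n × unitInterval, ∀ w, ‖w.1‖ < 1 ↔
      ‖(δ w).1.1‖ < 1 ∧ 0 < (δ w).2.1 ∧ (δ w).2.1 < 1 := by
  let Λ : EuclideanSpace ℝ (Fin (n + 1)) ≃L[ℝ] EuclideanSpace ℝ (Fin n) × ℝ :=
    ContinuousLinearEquiv.ofFinrankEq (by simp)
  let T : Set (EuclideanSpace ℝ (Fin n) × ℝ) := Metric.closedBall 0 1 ×ˢ unitInterval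
  have hT : IsCompact T := (isCompact_closedBall _ _).prod isCompact_Icc
  have hcpt : IsCompact (Λ ⁻¹' T) := Λ.toHomeomorph.isCompact_preimage.2 hT
  have hint : interior (Λ ⁻¹' T) = Λ ⁻¹' (Metric.ball 0 1 ×ˢ Ioo 0 1) := by
    rw [← interior_Icc, ← interior_closedBall _ one_ne_zero, ← interior_prod_eq]
    exact (Λ.toHomeomorph.preimage_interior T).symm
  -- Two bounded convex sets with nonempty interior in the same space are matched by an ambient
  -- homeomorphism, respecting interiors and closures.
  obtain ⟨h, h1, h2, -⟩ := exists_homeomorph_image_eq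
    (convex_closedBall (0 : EuclideanSpace ℝ (Fin (n + 1))) 1)
    ⟨0, by rw [interior_closedBall _ one_ne_zero]; exact Metric.mem_ball_self one_pos⟩
    (NormedSpace.isVonNBounded_closedBall ℝ _ _)
    (((convex_closedBall _ _).prod (convex_Icc _ _)).linear_preimage
      (Λ : EuclideanSpace ℝ (Fin (n + 1)) →ₗ[ℝ] EuclideanSpace ℝ (Fin n) × ℝ))
    (by
      refine ⟨Λ.symm (0, 1 / 2), ?_⟩
      refine hint.symm ▸ ?_
      simp only [mem_preimage, ContinuousLinearEquiv.apply_symm_apply]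
      exact ⟨Metric.mem_ball_self one_pos, by norm_num, by norm_num⟩)
    ((NormedSpace.isVonNBounded_iff ℝ).2 hcpt.isBounded)
  replace h1 : h '' Metric.ball 0 1 = Λ ⁻¹' (Metric.ball 0 1 ×ˢ Ioo 0 1) := by
    rw [← hint, ← interior_closedBall _ one_ne_zero]
    exact h1
  replace h2 : h '' Metric.closedBall 0 1 = Λ ⁻¹' T := by
    rw [Metric.isClosed_closedBall.closure_eq] at h2
    exact h2.trans hcpt.isClosed.closure_eq
  refine ⟨((h.trans Λ.toHomeomorph).subtype (q := (· ∈ T)) fun w => ?_).trans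
    (Homeomorph.Set.prod _ _), fun w => ?_⟩
  · rw [← h.injective.mem_set_image, h2]
    rfl
  · rw [← mem_ball_zero_iff, ← h.injective.mem_set_image, h1]
    change (_ ∈ Metric.ball _ _ ∧ _ ∈ Ioo _ _) ↔ _
    rw [mem_ball_zero_iff]
    rfl

/-- A homeomorphism between the disc `D^(n+1)` and the prism `D^n × [0, 1]`. -/
noncomputable def UnitDisc.prism (n : ℕ) : UnitDisc (n + 1) ≃ₜ UnitDisc n × unitInterval :=
  (UnitDisc.exists_homeomorph_prism n).choose

lemma UnitDisc.norm_lt_iff_prism {n : ℕ} (w : UnitDisc (n + 1)) :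
    ‖w.1‖ < 1 ↔ ‖(prism n w).1.1‖ < 1 ∧ 0 < (prism n w).2.1 ∧ (prism n w).2.1 < 1 :=
  (UnitDisc.exists_homeomorph_prism n).choose_spec w

/-- Below height `N` only the sets with `k < N` occur, so the family is locally finite. -/
lemma isClosed_iUnion_of_height {Z : Type*} [TopologicalSpace Z] {F : ℕ → Set (Z × ℝ≥0)}
    (hF : ∀ k, IsClosed (F k)) (h : ∀ k, ∀ p ∈ F k, k ≤ p.2) : IsClosed (⋃ k, F k) := by
  refine LocallyFinite.isClosed_iUnion (fun p => ?_) hF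
  obtain ⟨N, hN⟩ := exists_nat_gt p.2
  refine ⟨{q | q.2 < N}, (isOpen_lt continuous_snd continuous_const).mem_nhds hN,
    (finite_lt_nat N).subset ?_⟩
  rintro k ⟨q, hq, hqN⟩
  exact Nat.cast_lt.1 ((h k q hq).trans_lt hqN)

namespace GComplex.Labelling

open Thickening

section Cells

variable {G : Type u} [Group G] {X : Type v} [TopologicalSpace X] [MulAction G X]
  [ContinuousConstSMul G X] {C : GComplex G X} {W : Type w} [MulAction G W] (L : Labelling C W)

/-- Triples of a cell, a level and a label are identified if the labels are related. -/
def cellSetoid (n : ℕ) : Setoid (C.Cell n × ℕ × W) where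
  r p q := p.1 = q.1 ∧ p.2.1 = q.2.1 ∧
    L.rel (C.map p.1 (UnitDisc.center n)) p.2.1 p.2.2 q.2.2
  iseqv :=
    { refl := fun _ => ⟨rfl, rfl, (L.rel _ _).refl _⟩
      symm := fun h => ⟨h.1.symm, h.2.1.symm, h.1 ▸ h.2.1 ▸ (L.rel _ _).symm h.2.2⟩
      trans := fun h h' => ⟨h.1.trans h'.1, h.2.1.trans h'.2.1,
        (L.rel _ _).trans h.2.2 (h.1 ▸ h.2.1 ▸ h'.2.2)⟩ }

/-- The cells of `X` decorated with a level and a label. -/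
def LabelledCell (n : ℕ) : Type (max u v w) := Quotient (L.cellSetoid n)

/-- The cell `e` with level `k` and label `a`. -/
def labelledCell {n : ℕ} (e : C.Cell n) (k : ℕ) (a : W) : L.LabelledCell n :=
  Quotient.mk (L.cellSetoid n) (e, k, a)

variable {L}

lemma labelledCell_eq {n : ℕ} {e : C.Cell n} {k : ℕ} {a b : W}
    (h : L.rel (C.map e (UnitDisc.center n)) k a b) :
    L.labelledCell e k a = L.labelledCell e k b :=
  Quotient.sound (s := L.cellSetoid n) ⟨rfl, rfl, h⟩

lemma exists_labelledCell {n : ℕ} (c : L.LabelledCell n) :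
    ∃ e k a, L.labelledCell e k a = c := by
  obtain ⟨⟨e, k, a⟩, rfl⟩ := Quotient.exists_rep c
  exact ⟨e, k, a, rfl⟩

instance (n : ℕ) : SMul G (L.LabelledCell n) where
  smul g := Quotient.lift (fun p : C.Cell n × ℕ × W => L.labelledCell (g • p.1) p.2.1 (g • p.2.2))
    (by
      rintro ⟨e, k, a⟩ ⟨e', k', b⟩ ⟨h1, h2, h3⟩
      obtain rfl : e = e' := h1
      obtain rfl : k = k' := h2
      exact labelledCell_eq (C.map_smul g e _ ▸ L.smul_rel g h3))

lemma smul_labelledCell {n : ℕ} (g : G) (e : C.Cell n) (k : ℕ) (a : W) :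
    g • L.labelledCell e k a = L.labelledCell (g • e) k (g • a) := rfl

instance (n : ℕ) : MulAction G (L.LabelledCell n) where
  one_smul c := by
    obtain ⟨e, k, a, rfl⟩ := exists_labelledCell c
    rw [smul_labelledCell, one_smul, one_smul]
  mul_smul g h c := by
    obtain ⟨e, k, a, rfl⟩ := exists_labelledCell c
    simp only [smul_labelledCell, mul_smul]

/-- The map of the prism over a labelled cell to the thickening. -/
noncomputable def LabelledCell.map {n : ℕ} (c : L.LabelledCell n)
    (p : UnitDisc n × unitInterval) : L.Thickening :=
  Quotient.lift (fun q : C.Cell n × ℕ × W =>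
    point L (C.map q.1 p.1) (q.2.1 + unitInterval.toNNReal p.2) q.2.2)
    (by
      rintro ⟨e, k, a⟩ ⟨e', k', b⟩ ⟨h1, h2, h3⟩
      obtain rfl : e = e' := h1
      obtain rfl : k = k' := h2
      refine point_eq (L.rel_of_interior e p.1 (UnitDisc.norm_center_lt n) (L.mono ?_ h3))
      exact Nat.le_floor le_self_add) c

lemma map_labelledCell {n : ℕ} (e : C.Cell n) (k : ℕ) (a : W) (p : UnitDisc n × unitInterval) :
    (L.labelledCell e k a).map p =
      point L (C.map e p.1) (k + unitInterval.toNNReal p.2) a := rfl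

lemma LabelledCell.map_smul {n : ℕ} (g : G) (c : L.LabelledCell n)
    (p : UnitDisc n × unitInterval) : (g • c).map p = g • c.map p := by
  obtain ⟨e, k, a, rfl⟩ := exists_labelledCell c
  rw [smul_labelledCell, map_labelledCell, map_labelledCell, smul_point, C.map_smul]

lemma LabelledCell.continuous_map {n : ℕ} (c : L.LabelledCell n) : Continuous c.map := by
  obtain ⟨e, k, a, rfl⟩ := exists_labelledCell c
  exact (continuous_point a).comp (((C.continuous_map e).comp continuous_fst).prodMk
    (by fun_prop : Continuous fun p : UnitDisc n × unitInterval =>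
      (k + unitInterval.toNNReal p.2 : ℝ≥0)))

/-- Away from the top of the prism, the level is the floor of the height, so the image point
determines all the data. -/
lemma LabelledCell.map_inj {n : ℕ} {c c' : L.LabelledCell n} {p p' : UnitDisc n × unitInterval}
    (hp : ‖p.1.1‖ < 1) (hp' : ‖p'.1.1‖ < 1) (ht : p.2.1 < 1) (ht' : p'.2.1 < 1)
    (h : c.map p = c'.map p') : c = c' ∧ p = p' := by
  obtain ⟨e, k, a, rfl⟩ := exists_labelledCell c
  obtain ⟨e', k', a', rfl⟩ := exists_labelledCell c'
  obtain ⟨z, t⟩ := p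
  obtain ⟨z', t'⟩ := p'
  obtain ⟨h1, h2, h3⟩ := point_eq_point.1 h
  obtain ⟨rfl, rfl⟩ := C.map_inj hp hp' h1
  have hfloor : ∀ (k : ℕ) (t : unitInterval), t.1 < 1 →
      ⌊(k + unitInterval.toNNReal t : ℝ≥0)⌋₊ = k := fun k t ht => by
    rw [add_comm, Nat.floor_add_natCast zero_le, Nat.floor_eq_zero.2, zero_add]
    exact NNReal.coe_lt_coe.1 (by simpa using ht)
  have hk : k = k' := by
    rw [← hfloor k t ht, ← hfloor k' t' ht']
    exact congrArg _ h2
  subst hk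
  have ht : t = t' := Subtype.ext (by simpa using congrArg NNReal.toReal (add_left_cancel h2))
  subst ht
  refine ⟨labelledCell_eq (L.rel_of_interior e _ hp ?_), rfl⟩
  rwa [hfloor k t (by assumption)] at h3

variable (L) in
/-- The cells of the thickening. -/
inductive ThickCell : ℕ → Type (max u v w)
  | flat {n : ℕ} (c : L.LabelledCell n) : ThickCell n
  | prism {n : ℕ} (c : L.LabelledCell n) : ThickCell (n + 1)

namespace ThickCell

instance (n : ℕ) : SMul G (L.ThickCell n) where
  smul g c := match c with
    | flat c => flat (g • c)
    | prism c => prism (g • c)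

lemma smul_flat {n : ℕ} (g : G) (c : L.LabelledCell n) : g • flat c = flat (g • c) := rfl

lemma smul_prism {n : ℕ} (g : G) (c : L.LabelledCell n) : g • prism c = prism (g • c) := rfl

instance (n : ℕ) : MulAction G (L.ThickCell n) where
  one_smul c := by
    cases c
    · rw [smul_flat, one_smul]
    · rw [smul_prism, one_smul]
  mul_smul g h c := by
    cases c
    · simp only [smul_flat, mul_smul]
    · simp only [smul_prism, mul_smul]

/-- The characteristic map of a cell of the thickening. -/
noncomputable def map : ∀ {n : ℕ}, L.ThickCell n → UnitDisc n → L.Thickening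
  | _, flat c, z => c.map (z, 0)
  | _, prism c, z => c.map (UnitDisc.prism _ z)

lemma map_flat {n : ℕ} (c : L.LabelledCell n) (z : UnitDisc n) :
    (flat c).map z = c.map (z, 0) := rfl

lemma map_prism {n : ℕ} (c : L.LabelledCell n) (z : UnitDisc (n + 1)) :
    (prism c).map z = c.map (UnitDisc.prism n z) := rfl

lemma map_smul {n : ℕ} (g : G) (c : L.ThickCell n) (z : UnitDisc n) :
    (g • c).map z = g • c.map z := by
  cases c
  · rw [smul_flat, map_flat, map_flat, LabelledCell.map_smul]
  · rw [smul_prism, map_prism, map_prism, LabelledCell.map_smul]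

lemma continuous_map {n : ℕ} (c : L.ThickCell n) : Continuous c.map := by
  cases c with
  | flat c => exact c.continuous_map.comp (by fun_prop : Continuous fun z : UnitDisc n =>
      (z, (0 : unitInterval)))
  | prism c => exact c.continuous_map.comp (UnitDisc.prism _).continuous

end ThickCell

variable (L) in
/-- The points of the thickening over `skelLT n` at integral height together with those over
`skelLT (n - 1)`. -/
def skel (n : ℕ) : Set L.Thickening :=
  -- A prism has one dimension more than its base, whence `n - 1`. For `n = 0` truncation is
  -- harmless, as `C.skelLT 0` is empty.
  {y | (proj L y ∈ C.skelLT n ∧ ∃ k : ℕ, height L y = k) ∨ proj L y ∈ C.skelLT (n - 1)}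

lemma point_mem_skel {n : ℕ} {x : X} {t : ℝ≥0} {a : W} : point L x t a ∈ L.skel n ↔
    (x ∈ C.skelLT n ∧ ∃ k : ℕ, t = k) ∨ x ∈ C.skelLT (n - 1) := Iff.rfl

lemma isClosed_skel (n : ℕ) : IsClosed (L.skel n) :=
  have h : IsClosed {t : ℝ≥0 | ∃ k : ℕ, t = k} := by
    have := (Nat.isClosedEmbedding_coe_real.isClosed_range).preimage NNReal.continuous_coe
    convert this using 1
    ext t
    simp only [mem_ofPred_eq, mem_preimage, mem_range]
    exact exists_congr fun k => by rw [← NNReal.coe_natCast, NNReal.coe_inj, eq_comm]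
  (((C.isClosed_skelLT n).preimage (proj L).continuous).inter
    (h.preimage (height L).continuous)).union
    ((C.isClosed_skelLT (n - 1)).preimage (proj L).continuous)

lemma ThickCell.map_mem {n : ℕ} (c : L.ThickCell n) (z : UnitDisc n) (hz : ‖z.1‖ = 1) :
    c.map z ∈ L.skel n := by
  cases c with
  | flat c =>
    obtain ⟨e, k, a, rfl⟩ := exists_labelledCell c
    exact Or.inl ⟨C.map_mem_of_norm_eq e z hz, k, by simp [map_flat, map_labelledCell]⟩
  | @prism n c =>
    obtain ⟨e, k, a, rfl⟩ := exists_labelledCell c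
    rw [map_prism, map_labelledCell, point_mem_skel]
    rcases (UnitDisc.prism n z).1.norm_lt_or_eq with h | h
    · refine Or.inl ⟨C.map_mem _ _, ?_⟩
      have h' := mt (UnitDisc.norm_lt_iff_prism z).2 hz.not_lt
      rcases (UnitDisc.prism n z).2.2.1.eq_or_lt with h0 | h0
      · exact ⟨k, by rw [show (UnitDisc.prism n z).2 = 0 from Subtype.ext h0.symm]; simp⟩
      · have h1 : (UnitDisc.prism n z).2 = 1 := Subtype.ext
          ((UnitDisc.prism n z).2.2.2.antisymm (not_lt.1 fun h1 => h' ⟨h, h0, h1⟩))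
        exact ⟨k + 1, by rw [h1]; simp⟩
    · exact Or.inr (C.map_mem_of_norm_eq _ _ h)

lemma ThickCell.map_notMem {n : ℕ} (c : L.ThickCell n) (z : UnitDisc n) (hz : ‖z.1‖ < 1) :
    c.map z ∉ L.skel n := by
  cases c with
  | flat c =>
    obtain ⟨e, k, a, rfl⟩ := exists_labelledCell c
    rw [map_flat, map_labelledCell, point_mem_skel]
    have h := C.map_notMem e z hz
    exact fun h' => h'.elim (fun h' => h h'.1) fun h' => h (C.skelLT_mono (n.sub_le 1) h')
  | @prism n c =>
    obtain ⟨e, k, a, rfl⟩ := exists_labelledCell c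
    rw [map_prism, map_labelledCell, point_mem_skel]
    obtain ⟨h1, h2, h3⟩ := (UnitDisc.norm_lt_iff_prism z).1 hz
    rintro (⟨-, l, hl⟩ | h)
    · have hl' : (k : ℝ) + (UnitDisc.prism n z).2.1 = l := by
        simpa using congrArg NNReal.toReal hl
      have h4 : (k : ℝ) < l := by linarith
      have h5 : (l : ℝ) < (k + 1 : ℕ) := by push_cast; linarith
      have := Nat.cast_lt.1 h4
      have := Nat.cast_lt.1 h5
      omega
    · exact C.map_notMem e _ h1 h

lemma ThickCell.map_inj {n : ℕ} (c c' : L.ThickCell n) (z z' : UnitDisc n) (hz : ‖z.1‖ < 1)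
    (hz' : ‖z'.1‖ < 1) (h : c.map z = c'.map z') : c = c' ∧ z = z' := by
  -- An open flat cell lies over an open `(m+1)`-cell, whereas a prism of the same dimension lies
  -- over the `m`-skeleton.
  have aux : ∀ {m : ℕ} (c : L.LabelledCell (m + 1)) (c' : L.LabelledCell m)
      {z z' : UnitDisc (m + 1)}, ‖z.1‖ < 1 → (flat c).map z ≠ (prism c').map z' := by
    intro m c c' z z' hz h
    obtain ⟨e, k, a, rfl⟩ := exists_labelledCell c
    obtain ⟨e', k', a', rfl⟩ := exists_labelledCell c'
    exact C.map_notMem e z hz ((point_eq_point.1 h).1 ▸ C.map_mem e' _)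
  cases c with
  | flat c =>
    cases c' with
    | flat c' =>
      obtain ⟨rfl, h2⟩ := LabelledCell.map_inj (p := (z, 0)) (p' := (z', 0)) hz hz'
        (by simp) (by simp) h
      exact ⟨rfl, congrArg Prod.fst h2⟩
    | prism c' => exact absurd h (aux c c' hz)
  | prism c =>
    cases c' with
    | flat c' => exact absurd h.symm (aux c' c hz')
    | prism c' =>
      obtain ⟨h1, -, h2⟩ := (UnitDisc.norm_lt_iff_prism z).1 hz
      obtain ⟨h1', -, h2'⟩ := (UnitDisc.norm_lt_iff_prism z').1 hz'
      obtain ⟨rfl, h3⟩ := LabelledCell.map_inj h1 h1' h2 h2' h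
      exact ⟨rfl, (UnitDisc.prism _).injective h3⟩

lemma skel_zero : L.skel 0 = ∅ := by
  simp [skel, C.skelLT_zero]

lemma skel_succ (n : ℕ) : L.skel (n + 1) = L.skel n ∪ ⋃ c : L.ThickCell n, range c.map := by
  ext y
  simp only [mem_union, mem_iUnion, mem_range]
  constructor
  · obtain ⟨x, t, a, rfl⟩ := exists_point y
    rw [point_mem_skel, point_mem_skel, Nat.add_sub_cancel]
    rintro (⟨hx, k, rfl⟩ | hx)
    · rcases C.exists_of_mem_skelLT_succ hx with hx | ⟨e, z, rfl⟩
      · exact Or.inl (Or.inl ⟨hx, k, rfl⟩)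
      · exact Or.inr ⟨.flat (L.labelledCell e k a), z, by
          simp [ThickCell.map_flat, map_labelledCell]⟩
    · cases n with
      | zero => simp [C.skelLT_zero] at hx
      | succ n =>
        rcases C.exists_of_mem_skelLT_succ hx with hx | ⟨e, z, rfl⟩
        · exact Or.inl (Or.inr hx)
        · refine Or.inr ⟨.prism (L.labelledCell e ⌊t⌋₊ a), (UnitDisc.prism n).symm
            (z, ⟨(t - ⌊t⌋₊ : ℝ), sub_nonneg.2 (Nat.floor_le t.2), ?_⟩), ?_⟩
          · have := (Nat.lt_floor_add_one t).le
            rw [sub_le_iff_le_add']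
            exact_mod_cast this
          · rw [ThickCell.map_prism, Homeomorph.apply_symm_apply, map_labelledCell]
            congr 1
            apply NNReal.coe_injective
            simp
  · rintro (h | ⟨c, z, rfl⟩)
    · refine h.imp (fun h => ⟨C.skelLT_mono n.le_succ h.1, h.2⟩) fun h => ?_
      exact C.skelLT_mono (n.sub_le 1) h
    · cases c with
      | flat c =>
        obtain ⟨e, k, a, rfl⟩ := exists_labelledCell c
        exact Or.inl ⟨C.map_mem e z, k, by simp [ThickCell.map_flat, map_labelledCell]⟩
      | prism c =>
        obtain ⟨e, k, a, rfl⟩ := exists_labelledCell c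
        exact Or.inr (C.map_mem e _)

/-- Closedness is tested for each label in `X × ℝ≥0`, and there over each cell of `X`, because `ℝ≥0`
is locally compact. What remains is to cut each column `e × ℝ≥0` at integral heights. -/
lemma isClosed_iff_of_subset_skel {n : ℕ} {A : Set L.Thickening} (hA : A ⊆ L.skel (n + 1)) :
    IsClosed A ↔ IsClosed (A ∩ L.skel n) ∧ ∀ c : L.ThickCell n, IsClosed (c.map ⁻¹' A) := by
  refine ⟨fun h => ⟨h.inter (isClosed_skel n), fun c => h.preimage c.continuous_map⟩, ?_⟩
  rintro ⟨h1, h2⟩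
  refine Thickening.isClosed_iff.2 fun a => ?_
  have hcont : ∀ {m : ℕ} (e : C.Cell m),
      Continuous fun p : UnitDisc m × ℝ≥0 => point L (C.map e p.1) p.2 a := fun e =>
    (continuous_point a).comp (((C.continuous_map e).comp continuous_fst).prodMk continuous_snd)
  have low : ∀ m < n, ∀ e : C.Cell m,
      IsClosed {p : UnitDisc m × ℝ≥0 | point L (C.map e p.1) p.2 a ∈ A} := by
    intro m hm e
    -- Columns over cells of dimension below `n - 1` lie in `L.skel n`; those of dimension `n - 1`
    -- are locally finite unions of prisms.
    rcases (Nat.succ_le_of_lt hm).lt_or_eq with hm | rfl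
    · convert h1.preimage (hcont e) using 1
      ext p
      exact (and_iff_left (Or.inr (C.skelLT_mono (Nat.le_sub_one_of_lt hm) (C.map_mem e p.1)))).symm
    · let F : ℕ → Set (UnitDisc m × ℝ≥0) := fun k =>
        {p | k ≤ p.2 ∧ p.2 ≤ k + 1} ∩ (fun p : UnitDisc m × ℝ≥0 =>
          (UnitDisc.prism m).symm (p.1, projIcc 0 1 zero_le_one ((p.2 : ℝ) - k))) ⁻¹'
            ((ThickCell.prism (L.labelledCell e k a)).map ⁻¹' A)
      have hF : {p : UnitDisc m × ℝ≥0 | point L (C.map e p.1) p.2 a ∈ A} = ⋃ k, F k := by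
        have key : ∀ (k : ℕ) (p : UnitDisc m × ℝ≥0), k ≤ p.2 → p.2 ≤ k + 1 →
            (ThickCell.prism (L.labelledCell e k a)).map ((UnitDisc.prism m).symm
              (p.1, projIcc 0 1 zero_le_one ((p.2 : ℝ) - k))) = point L (C.map e p.1) p.2 a := by
          intro k p hk hk'
          have hk0 : (0 : ℝ) ≤ p.2 - k := sub_nonneg.2 (by exact_mod_cast hk)
          have hk1 : (p.2 - k : ℝ) ≤ 1 := sub_le_iff_le_add'.2 (by exact_mod_cast hk')
          rw [ThickCell.map_prism, Homeomorph.apply_symm_apply, map_labelledCell,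
            projIcc_of_mem _ ⟨hk0, hk1⟩]
          congr 1
          apply NNReal.coe_injective
          simp
        ext p
        simp only [F, mem_ofPred_eq, mem_iUnion, mem_inter_iff, mem_preimage]
        constructor
        · intro hp
          have hl : (⌊p.2⌋₊ : ℝ≥0) ≤ p.2 := Nat.floor_le zero_le
          have hr := (Nat.lt_floor_add_one p.2).le
          exact ⟨⌊p.2⌋₊, ⟨hl, hr⟩, (key _ p hl hr).symm ▸ hp⟩
        · rintro ⟨k, ⟨hl, hr⟩, hp⟩
          exact key k p hl hr ▸ hp
      rw [hF]
      refine isClosed_iUnion_of_height (fun k => ?_) fun k p hp => hp.1.1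
      refine ((isClosed_le continuous_const continuous_snd).inter
        (isClosed_le continuous_snd continuous_const)).inter ((h2 _).preimage ?_)
      refine (UnitDisc.prism m).symm.continuous.comp (continuous_fst.prodMk
        (continuous_projIcc.comp ?_))
      fun_prop
  have hlow : IsClosed {p : X × ℝ≥0 | point L p.1 p.2 a ∈ A ∧ p.1 ∈ C.skelLT n} := by
    refine C.isClosed_prod_of_preimage (fun p hp => hp.2) fun m hm e => ?_
    convert low m hm e using 1
    ext p
    exact and_iff_left (C.skelLT_mono hm (C.map_mem e p.1))
  refine C.isClosed_prod_of_preimage (n := n + 1) (fun p hp => ?_) fun m hm e => ?_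
  · exact (hA hp).elim (fun h => h.1) fun h => C.skelLT_mono n.le_succ h
  · rcases Nat.lt_succ_iff_lt_or_eq.1 hm with hm | rfl
    · exact low m hm e
    -- Over an open `n`-cell, `A` has points at integral heights only; the rest lies over the lower
    -- skeleton, settled by `hlow`.
    · let F : ℕ → Set (UnitDisc m × ℝ≥0) := fun k =>
        {p | p.2 = k} ∩ Prod.fst ⁻¹' ((ThickCell.flat (L.labelledCell e k a)).map ⁻¹' A)
      have key : ∀ (k : ℕ) (z : UnitDisc m), (ThickCell.flat (L.labelledCell e k a)).map z =
          point L (C.map e z) k a := fun k z => by simp [ThickCell.map_flat, map_labelledCell]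
      have hF : {p : UnitDisc m × ℝ≥0 | point L (C.map e p.1) p.2 a ∈ A} = (⋃ k, F k) ∪
          (fun p : UnitDisc m × ℝ≥0 => (C.map e p.1, p.2)) ⁻¹'
            {p | point L p.1 p.2 a ∈ A ∧ p.1 ∈ C.skelLT m} := by
        ext ⟨z, t⟩
        simp only [F, mem_ofPred_eq, mem_union, mem_iUnion, mem_inter_iff, mem_preimage, key]
        constructor
        · intro hp
          rcases hA hp with ⟨-, k, rfl⟩ | h
          · exact Or.inl ⟨k, rfl, hp⟩
          · exact Or.inr ⟨hp, h⟩
        · rintro (⟨k, rfl, hp⟩ | hp)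
          · exact hp
          · exact hp.1
      change IsClosed {p : UnitDisc m × ℝ≥0 | point L (C.map e p.1) p.2 a ∈ A}
      rw [hF]
      refine (isClosed_iUnion_of_height (fun k => ?_) fun k p hp => hp.1.ge).union
        (hlow.preimage (((C.continuous_map e).comp continuous_fst).prodMk continuous_snd))
      exact (isClosed_eq continuous_snd continuous_const).inter ((h2 _).preimage continuous_fst)

end Cells

variable {G : Type u} [Group G] {X : Type v} [TopologicalSpace X] [MulAction G X]
  [ContinuousConstSMul G X] {C : GComplex G X} {W : Type (max u v)} [MulAction G W]
  (L : Labelling C W)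

/-- The thickening of a finite dimensional `G`-complex is a `G`-complex. -/
noncomputable def gComplex (hC : C.FiniteDimensional) : GComplex G L.Thickening :=
  have key : ∃ N, L.skel N = univ := by
    obtain ⟨N, hN⟩ := hC.exists_skelLT_eq_univ
    exact ⟨N + 1, eq_univ_of_forall fun y => Or.inr (hN ▸ mem_univ _)⟩
  ofCells L.ThickCell (fun _ c => c.map) L.skel (fun _ => ThickCell.map_smul)
    (fun _ => ThickCell.continuous_map) skel_zero skel_succ (fun _ => ThickCell.map_mem)
    (fun _ => ThickCell.map_notMem) (fun _ => ThickCell.map_inj)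
    (fun _ _ => isClosed_iff_of_subset_skel)
    (by
      obtain ⟨N, hN⟩ := key
      exact eq_univ_of_univ_subset (hN ▸ subset_iUnion L.skel N))
    (fun A hA => by
      obtain ⟨N, hN⟩ := key
      simpa [hN] using hA N)

lemma finiteDimensional_gComplex (hC : C.FiniteDimensional) :
    (L.gComplex hC).FiniteDimensional := by
  obtain ⟨N, hN⟩ := id hC
  refine ⟨N + 1, fun n hn => ⟨fun i => ?_⟩⟩
  have hcell : ∀ m, N < m → L.LabelledCell m → False := fun m hm c => by
    obtain ⟨e, -⟩ := exists_labelledCell c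
    exact (hN m hm).false e.1
  have c : L.ThickCell n := Quotient.out (s := MulAction.orbitRel G (L.ThickCell n)) i
  cases c with
  | flat c => exact hcell _ (by omega) c
  | prism c => exact hcell _ (by omega) c

end GComplex.Labelling

/-! ### Labels from coset representatives, and stabilizers -/

lemma Subgroup.exists_fg_exhaustion {G : Type u} [Group G] (H : Subgroup G) [Countable H] :
    ∃ F : ℕ → Subgroup G, Monotone F ∧ (∀ k, (F k).FG) ∧ ∀ h ∈ H, ∃ k, h ∈ F k := by
  obtain ⟨f, hf⟩ := exists_surjective_nat H
  refine ⟨fun k => Subgroup.closure ((fun i => (f i : G)) '' Iio k),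
    fun k l h => Subgroup.closure_mono (image_mono (Iio_subset_Iio h)), fun k => ?_, fun h hh => ?_⟩
  · exact (Subgroup.fg_iff _).2 ⟨_, rfl, (finite_Iio k).image _⟩
  · obtain ⟨i, hi⟩ := hf ⟨h, hh⟩
    exact ⟨i + 1, Subgroup.subset_closure ⟨i, i.lt_succ_self, by simp [hi]⟩⟩

lemma Subgroup.FG.map_monoidHom {G G' : Type*} [Group G] [Group G'] {H : Subgroup G} (h : H.FG)
    (f : G →* G') : (H.map f).FG := by
  obtain ⟨S, rfl, hS⟩ := (Subgroup.fg_iff _).1 h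
  exact (Subgroup.fg_iff _).2 ⟨f '' S, (MonoidHom.map_closure f S).symm, hS.image f⟩

namespace GComplex

variable {G : Type u} [Group G] {X : Type v} [TopologicalSpace X] [MulAction G X]
  [ContinuousConstSMul G X] (C : GComplex G X)

/-- The cells of all dimensions. -/
abbrev AnyCell : Type (max u v) := Σ n, C.Cell n

/-- The open cell `e'` meets the closed cell `e`. -/
def IsFace (e' e : C.AnyCell) : Prop :=
  ∃ z z', ‖z'.1‖ < 1 ∧ C.map e.2 z = C.map e'.2 z'

variable {C}

lemma IsFace.smul {e' e : C.AnyCell} (h : C.IsFace e' e) (g : G) : C.IsFace (g • e') (g • e) := by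
  obtain ⟨z, z', hz', h⟩ := h
  exact ⟨z, z', hz', (C.map_smul g e.2 z).trans
    ((congrArg (g • ·) h).trans (C.map_smul g e'.2 z').symm)⟩

lemma IsFace.eq_or_lt {e' e : C.AnyCell} (h : C.IsFace e' e) : e' = e ∨ e'.1 < e.1 := by
  obtain ⟨z, z', hz', h⟩ := h
  rcases z.norm_lt_or_eq with hz | hz
  · exact Or.inl (C.cell_eq hz hz' h).symm
  · refine Or.inr (lt_of_not_ge fun hle => C.map_notMem e'.2 z' hz' ?_)
    exact h ▸ C.skelLT_mono hle (C.map_mem_of_norm_eq e.2 z hz)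

/-- A face other than the cell itself has smaller dimension, and each cell has finitely many faces,
so induction on dimension applies. The transitive closure is needed because a closed cell may meet
an open cell without containing its closure. -/
lemma finite_below (e : C.AnyCell) : {e' | Relation.ReflTransGen C.IsFace e' e}.Finite := by
  have key : ∀ {e' e}, Relation.ReflTransGen C.IsFace e' e → e' = e ∨
      ∃ b, C.IsFace b e ∧ b.1 < e.1 ∧ Relation.ReflTransGen C.IsFace e' b := by
    intro e' e h
    induction h with
    | refl => exact Or.inl rfl
    | tail h1 h2 ih =>
      rcases h2.eq_or_lt with rfl | hlt
      · exact ih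
      · exact Or.inr ⟨_, h2, hlt, h1⟩
  induction hn : e.1 using Nat.strong_induction_on generalizing e with
  | _ n ih =>
    have hfin : {b | C.IsFace b e ∧ b.1 < n}.Finite :=
      (C.finite_cells_meeting e.2).subset fun b hb => hb.1
    refine ((hfin.biUnion fun b hb => ih b.1 hb.2 b rfl).insert e).subset fun e' he' => ?_
    rcases key he' with rfl | ⟨b, h1, h2, h3⟩
    · exact mem_insert _ _
    · exact mem_insert_of_mem _ (mem_biUnion (x := b) ⟨h1, hn ▸ h2⟩ h3)

variable (C) in
/-- The open cell containing a point. -/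
noncomputable def carrier (x : X) : C.AnyCell :=
  ⟨_, (C.exists_interior x).choose_spec.choose⟩

lemma carrier_map {n : ℕ} (e : C.Cell n) {z : UnitDisc n} (hz : ‖z.1‖ < 1) :
    C.carrier (C.map e z) = ⟨n, e⟩ :=
  have h := (C.exists_interior (C.map e z)).choose_spec.choose_spec.choose_spec
  C.cell_eq h.1 hz h.2

lemma carrier_smul (g : G) (x : X) : C.carrier (g • x) = g • C.carrier x := by
  obtain ⟨n, e, z, hz, rfl⟩ := C.exists_interior x
  rw [← C.map_smul, carrier_map _ hz, carrier_map _ hz]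
  rfl

lemma isFace_carrier_map {n : ℕ} (e : C.Cell n) (z : UnitDisc n) :
    C.IsFace (C.carrier (C.map e z)) ⟨n, e⟩ := by
  obtain ⟨m, e', z', hz', h⟩ := C.exists_interior (C.map e z)
  rw [← h, carrier_map _ hz']
  exact ⟨z, z', hz', h.symm⟩

variable (C) in
/-- The cells in the smallest subcomplex containing a point. -/
def hull (x : X) : Set C.AnyCell := {e | Relation.ReflTransGen C.IsFace e (C.carrier x)}

lemma carrier_mem_hull (x : X) : C.carrier x ∈ C.hull x := Relation.ReflTransGen.refl

/-- This monotonicity makes the relations coarser on boundaries; comparing labels on the carrier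
alone would not give it. -/
lemma hull_map_subset {n : ℕ} (e : C.Cell n) {z : UnitDisc n} (hz : ‖z.1‖ < 1) (z' : UnitDisc n) :
    C.hull (C.map e z') ⊆ C.hull (C.map e z) := fun e' he' => by
  have h : C.IsFace (C.carrier (C.map e z')) (C.carrier (C.map e z)) := by
    rw [carrier_map e hz]
    exact isFace_carrier_map e z'
  exact Relation.ReflTransGen.tail he' h

lemma smul_mem_hull (g : G) {x : X} {e : C.AnyCell} (h : e ∈ C.hull x) :
    g • e ∈ C.hull (g • x) := by
  change Relation.ReflTransGen _ _ _
  rw [carrier_smul]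
  have h' : Relation.ReflTransGen C.IsFace e (C.carrier x) := h
  exact h'.lift (g • ·) fun _ _ h => h.smul g

/-- The subgroup of a cell fixes the image of the center of its base disc. -/
lemma countable_stab (h : ∀ x : X, Countable (MulAction.stabilizer G x)) (n : ℕ) (i : C.cell n) :
    Countable (C.stab n i) := by
  let e : C.Cell n := ⟨i, ((1 : G) : G ⧸ C.stab n i)⟩
  have hle : C.stab n i ≤ MulAction.stabilizer G (C.map e (UnitDisc.center n)) := fun g hg => by
    have : g • e = e := by
      refine Sigma.ext rfl (heq_of_eq ?_)
      change ((g * 1 : G) : G ⧸ C.stab n i) = ((1 : G) : G ⧸ C.stab n i)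
      rw [QuotientGroup.eq]
      simpa using hg
    rw [MulAction.mem_stabilizer_iff, ← C.map_smul, this]
  have := h (C.map e (UnitDisc.center n))
  exact (Subgroup.inclusion_injective hle).countable

variable (C) in
/-- The choices of representatives of the cosets indexing the cells. -/
def Section : Type (max u v) :=
  -- The cell `e` has stabilizer `a e * H * (a e)⁻¹`, so one exhaustion of `H` serves a whole orbit
  -- of cells.
  {a : C.AnyCell → G // ∀ e, (a e : G ⧸ C.stab e.1 e.2.1) = e.2.2}

namespace Section

instance : Nonempty C.Section := ⟨⟨fun e => e.2.2.out, fun _ => QuotientGroup.out_eq' _⟩⟩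

instance : SMul G C.Section where
  smul g a := ⟨fun e => g * a.1 (g⁻¹ • e), by
    rintro ⟨n, i, c⟩
    change g • ((a.1 ⟨n, i, g⁻¹ • c⟩ : G) : G ⧸ C.stab n i) = c
    rw [a.2 ⟨n, i, g⁻¹ • c⟩]
    exact smul_inv_smul g c⟩

lemma smul_apply (g : G) (a : C.Section) (e : C.AnyCell) : (g • a).1 e = g * a.1 (g⁻¹ • e) := rfl

instance : MulAction G C.Section where
  one_smul a := Subtype.ext (funext fun e => by rw [smul_apply, inv_one, one_smul, one_mul])
  mul_smul g h a := Subtype.ext (funext fun e => by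
    simp only [smul_apply, mul_inv_rev, mul_smul, mul_assoc])

end Section

/-- The labelling by sections, two of which are related at level `k` if their ratio on each cell of
the hull lies in the `k`-th term of an exhaustion of the corresponding subgroup. -/
def sectionLabelling (F : ∀ n, C.cell n → ℕ → Subgroup G) (hmono : ∀ n i, Monotone (F n i))
    (hF : ∀ n i, ∀ g ∈ C.stab n i, ∃ k, g ∈ F n i k) : Labelling C C.Section where
  rel x k :=
    -- Left translation by `g` cancels in the ratio, which gives equivariance.
    { r := fun a b => ∀ e ∈ C.hull x, (a.1 e)⁻¹ * b.1 e ∈ F e.1 e.2.1 k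
      iseqv :=
        { refl := fun a e _ => by simp [one_mem]
          symm := fun h e he => by simpa using inv_mem (h e he)
          trans := fun h h' e he => by simpa [mul_assoc] using mul_mem (h e he) (h' e he) } }
  mono hkl h e he := hmono _ _ hkl (h e he)
  rel_of_interior e _ z' _ _ _ hz h e' he' := h e' (hull_map_subset e hz z' he')
  exists_rel x a b := by
    have hex : ∀ e : C.AnyCell, ∃ k, (a.1 e)⁻¹ * b.1 e ∈ F e.1 e.2.1 k := fun e =>
      hF _ _ _ (QuotientGroup.eq.1 ((a.2 e).trans (b.2 e).symm))
    choose k hk using hex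
    have hfin : (C.hull x).Finite := finite_below _
    -- On each cell the ratio lies in `H`, hence in some term of its exhaustion; finiteness of the
    -- hull gives a common level.
    refine ⟨hfin.toFinset.sup k, fun e he => hmono _ _ ?_ (hk e)⟩
    exact Finset.le_sup (hfin.mem_toFinset.2 he)
  smul_rel g x k a b h e he := by
    have he' : g⁻¹ • e ∈ C.hull x := by simpa using smul_mem_hull g⁻¹ he
    have := h _ he'
    rwa [Section.smul_apply, Section.smul_apply, mul_inv_rev, mul_assoc, inv_mul_cancel_left]

open Labelling.Thickening in
-- An element `g` fixing the point fixes the open cell `e` containing `x`, so `(g • a) e = g * a e`.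
-- The relation on `e` then puts `(a e)⁻¹ * g * a e` in the `⌊t⌋₊`-th subgroup, and `g` in a
-- conjugate of it.
lemma exists_fg_stabilizer_le {F : ∀ n, C.cell n → ℕ → Subgroup G}
    (hmono : ∀ n i, Monotone (F n i)) (hF : ∀ n i, ∀ g ∈ C.stab n i, ∃ k, g ∈ F n i k)
    (hfg : ∀ n i k, (F n i k).FG) (y : (sectionLabelling F hmono hF).Thickening) :
    ∃ K : Subgroup G, K.FG ∧ MulAction.stabilizer G y ≤ K := by
  obtain ⟨x, t, a, rfl⟩ := exists_point y
  let e := C.carrier x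
  refine ⟨(F e.1 e.2.1 ⌊t⌋₊).map (MulAut.conj (a.1 e)).toMonoidHom, (hfg _ _ _).map_monoidHom _,
    fun g hg => ?_⟩
  obtain ⟨h1, -, h2⟩ := point_eq_point.1 (MulAction.mem_stabilizer_iff.1 hg).symm
  have h3 : (a.1 e)⁻¹ * (g • a).1 e ∈ F e.1 e.2.1 ⌊t⌋₊ := h2 e (carrier_mem_hull x)
  have he : g⁻¹ • e = e := by
    rw [inv_smul_eq_iff]
    exact (congrArg C.carrier h1).trans (carrier_smul g x)
  rw [Section.smul_apply, he] at h3
  exact ⟨_, h3, by simp [MulAut.conj_apply, mul_assoc]⟩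

end GComplex

theorem lemma2p6 {G : Type u} [Group G]
    {X : Type v} [TopologicalSpace X] [MulAction G X] [ContinuousConstSMul G X]
    (C : GComplex G X) (hC : C.FiniteDimensional) (hX : ContractibleSpace X)
    (hstab : ∀ x : X, Countable (MulAction.stabilizer G x)) :
    ∃ (Y : Type (max u v)) (_ : TopologicalSpace Y) (_ : MulAction G Y)
      (_ : ContinuousConstSMul G Y) (D : GComplex G Y),
      D.FiniteDimensional ∧ ContractibleSpace Y ∧
      (∃ f : C(Y, X), ∀ (g : G) (y : Y), f (g • y) = g • f y) ∧
      ∀ y : Y, ∃ K : Subgroup G, K.FG ∧ MulAction.stabilizer G y ≤ K := by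
  have hcount := GComplex.countable_stab (C := C) hstab
  choose F hmono hfg hF using fun (n : ℕ) (i : C.cell n) => (C.stab n i).exists_fg_exhaustion
  let L := GComplex.sectionLabelling F hmono hF
  exact ⟨L.Thickening, inferInstance, inferInstance, inferInstance, L.gComplex hC,
    L.finiteDimensional_gComplex hC, L.contractibleSpace_thickening hC,
    ⟨GComplex.Labelling.Thickening.proj L, GComplex.Labelling.Thickening.proj_smul⟩,
    GComplex.exists_fg_stabilizer_le hmono hF hfg⟩
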